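/- Let $H$ be a complex Hilbert space and $Q$ a (densely defined, closed, possibly unbounded) self-adjoint operator on $H$. **Hilbert space operator structures.** Let $\mathcal L=(0,-,i,+,(I_r)_{r\in\mathbb Q},\|\cdot\|,\Gamma)$. A Hilbert space operator structure $(H',\Gamma_{Q'})$ is the metric $\mathcal L$-structure on a complex Hilbert space $H'$ carrying a self-adjoint operator $Q'$, with the metric $\|v-w\|$, zero vector, negation, multiplication by $i$, addition, multiplication $I_r$ by rational $r$, the norm, and $\Gamma_{Q'}(v,w)=$ the distance in $H'\oplus H'$ from $(v,w)$ to the graph of $Q'$. In general a metric structure is a complete metric space with continuous interpretations of the function symbols and continuous real-valued interpretations of the predicate symbols; $\mathcal M\subseteq\mathcal N$ means that the universe of $\mathcal M$ is a subset of that of $\mathcal N$ and that the metric and all interpretations in $\mathcal M$ are the restrictions of those in $\mathcal N$; $\operatorname{dens}(\mathcal M)$ is the least cardinality of a dense subset. **Spectral equivalence.** The spectrum $\sigma(Q)$ is the set of $\lambda\in\mathbb C$ such that $Q-\lambda I$ is not injective, or does not have dense range, or is injective with dense range but has unbounded inverse. The essential spectrum $\sigma_e(Q)$ is the set of $\lambda\in\mathbb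 C$ such that $(Q-\lambda I)S\ne I+K$ for every bounded $S$ and every compact $K$. Write $Q_1\sim_\sigma Q_2$ if $\sigma(Q_1)=\sigma(Q_2)$, $\sigma_e(Q_1)=\sigma_e(Q_2)$, and $\dim\{x: Q_1x=\lambda x\}=\dim\{x: Q_2x=\lambda x\}$ for all $\lambda\in\sigma(Q_1)\setminus\sigma_e(Q_1)$. **The class.** Let $\mathcal K=\mathcal K_{(H,\Gamma_Q)}$ be the class of all Hilbert space operator structures $(H',\Gamma_{Q'})$ with $Q'\sim_\sigma Q$, and let $(H_1,\Gamma_{Q_1})\prec(H_2,\Gamma_{Q_2})$, for members of $\mathcal K$, mean that $H_1$ is a Hilbert subspace of $H_2$ and $Q_1\subseteq Q_2$ (inclusion of graphs). **Theorem.** $(\mathcal K,\prec)$ is a metric abstract elementary class, that is, $\prec$ is a partial order on $\mathcal K$ and: 1. (Closure under isomorphism) (a) If $\mathcal M\in\mathcal K$ and $\mathcal N$ is an $\mathcal L$-structure isomorphic to $\mathcal M$, then $\mathcal N\in\mathcal K$. (b) If $\mathcal N_1,\mathcal N_2,\mathcal M_1,\mathcal M_2\in\mathcal K$, $f_l:\mathcal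 N_l\simeq\mathcal M_l$ for $l=1,2$, $f_1\subseteq f_2$ and $\mathcal N_1\prec\mathcal N_2$, then $\mathcal M_1\prec\mathcal M_2$. 2. If $\mathcal M,\mathcal N\in\mathcal K$ and $\mathcal M\prec\mathcal N$, then $\mathcal M\subseteq\mathcal N$. 3. If $\mathcal M,\mathcal N,\mathcal M^*$ are $\mathcal L$-structures with $\mathcal M\subseteq\mathcal N$, $\mathcal M\prec\mathcal M^*$ and $\mathcal N\prec\mathcal M^*$, then $\mathcal M\prec\mathcal N$. 4. (Downward Löwenheim–Skolem) There is a cardinal $\kappa\ge\aleph_0+|\mathcal L|$ such that for every $\mathcal M\in\mathcal K$ and every subset $A$ of $\mathcal M$ there is $\mathcal N\in\mathcal K$ with $\mathcal N\prec\mathcal M$, $A\subseteq\mathcal N$ and $\operatorname{dens}(\mathcal N)\le|A|+\kappa$. 5. (Tarski–Vaught chains) Let $I$ be a nonempty well-ordered set, and let $\mathcal M_i\in\mathcal K$ $(i\in I)$ satisfy $\mathcal M_i\prec\mathcal M_j$ whenever $i<j$. A completion of the union of the $\mathcal M_i$ is an $\mathcal L$-structure that contains every $\mathcal M_i$ as a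 substructure and in which the union of the $\mathcal M_i$ is dense. (a) If $\mathcal N\in\mathcal K$ and $\mathcal M_i\prec\mathcal N$ for all $i$, then the union has a completion $\overline{\bigcup_i\mathcal M_i}$ that is a substructure of $\mathcal N$, and every such completion belongs to $\mathcal K$ and satisfies $\overline{\bigcup_i\mathcal M_i}\prec\mathcal N$. (b) In general the union has a completion, and every completion $\overline{\bigcup_i\mathcal M_i}$ belongs to $\mathcal K$ and satisfies $\mathcal M_j\prec\overline{\bigcup_i\mathcal M_i}$ for every $j\in I$. Moreover, the least cardinal $LS(\mathcal K)$ as in 4 satisfies $LS(\mathcal K)\le 2^{2^{\aleph_0}}$. -/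

import Mathlib

universe u v w a b

/-! ### Spectral theory of partially defined operators on a complex Hilbert space -/

namespace SpectralMAEC

section Spectral

variable {H : Type v} [NormedAddCommGroup H] [InnerProductSpace ℂ H]

/-- The operator `Q - l I`, with the domain of `Q`. -/
def shift (Q : H →ₗ.[ℂ] H) (l : ℂ) : Q.domain →ₗ[ℂ] H :=
  Q.toFun - l • Q.domain.subtype

/-- The eigenvalues: `Q - l I` is not one-to-one. -/
def pointSpectrum (Q : H →ₗ.[ℂ] H) : Set ℂ :=
  {l | ¬ Function.Injective (shift Q l)}

/-- The continuous spectrum: `Q - l I` is one-to-one and its inverse is densely defined but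
unbounded. -/
def continuousSpectrum (Q : H →ₗ.[ℂ] H) : Set ℂ :=
  {l | Function.Injective (shift Q l) ∧ DenseRange (shift Q l) ∧
    ¬ ∃ C : ℝ, ∀ v : Q.domain, ‖(v : H)‖ ≤ C * ‖shift Q l v‖}

/-- The residual spectrum: the range of `Q - l I` is not dense. -/
def residualSpectrum (Q : H →ₗ.[ℂ] H) : Set ℂ :=
  {l | ¬ DenseRange (shift Q l)}

/-- The spectrum of `Q`. -/
def operatorSpectrum (Q : H →ₗ.[ℂ] H) : Set ℂ :=
  pointSpectrum Q ∪ continuousSpectrum Q ∪ residualSpectrum Q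

/-- The essential spectrum: the complex `l` such that `(Q - l I) S ≠ I + K` for all bounded `S` and
all compact `K`. The equality `(Q - l I) S = I + K` is an equality of operators, so it
says in particular that `S` maps the whole space into the domain of `Q`. -/
def essentialSpectrum (Q : H →ₗ.[ℂ] H) : Set ℂ :=
  {l | ¬ ∃ S K : H →L[ℂ] H, IsCompactOperator K ∧
    ∀ v : H, ∃ h : S v ∈ Q.domain, shift Q l ⟨S v, h⟩ = v + K v}

/-- The space of all `x` with `Q x = l x`. -/
def eigenspace (Q : H →ₗ.[ℂ] H) (l : ℂ) : Submodule ℂ H :=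
  (LinearMap.ker (shift Q l)).map Q.domain.subtype

/-- Spectral equivalence: same spectrum, same essential spectrum, and eigenspaces of the same
dimension at every point of the spectrum outside the essential spectrum. -/
def SpectrallyEquivalent {H₁ : Type v} [NormedAddCommGroup H₁] [InnerProductSpace ℂ H₁]
    {H₂ : Type w} [NormedAddCommGroup H₂] [InnerProductSpace ℂ H₂]
    (Q₁ : H₁ →ₗ.[ℂ] H₁) (Q₂ : H₂ →ₗ.[ℂ] H₂) : Prop :=
  operatorSpectrum Q₁ = operatorSpectrum Q₂ ∧
  essentialSpectrum Q₁ = essentialSpectrum Q₂ ∧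
  ∀ l ∈ operatorSpectrum Q₁ \ essentialSpectrum Q₁,
    Cardinal.lift.{w} (Module.rank ℂ (eigenspace Q₁ l)) =
      Cardinal.lift.{v} (Module.rank ℂ (eigenspace Q₂ l))

/-- The distance of `(v, w)` to the graph of `Q`, in the Hilbert space `H ⊕ H`. -/
noncomputable def graphDist (Q : H →ₗ.[ℂ] H) (v w : H) : ℝ :=
  Metric.infDist (WithLp.toLp 2 (v, w))
    {p : WithLp 2 (H × H) | (p.fst, p.snd) ∈ Q.graph}

theorem continuous_graphDist (Q : H →ₗ.[ℂ] H) :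
    Continuous fun x : Fin 2 → H => graphDist Q (x 0) (x 1) :=
  ((Metric.continuous_infDist_pt _).comp (WithLp.prod_continuous_toLp 2 H H)).comp
    ((continuous_apply (0 : Fin 2)).prodMk (continuous_apply (1 : Fin 2)))

end Spectral

/-! ### Metric structures whose universes are sets, and metric abstract elementary classes -/

section MAEC

/-- A metric structure for the similarity type `L`: a complete metric space, whose underlying set
is a set `carrier` in the set-theoretic universe `ZFSet`, with continuous interpretations of the
function symbols (constants being function symbols of arity `0`) and continuous real-valued
interpretations of the predicate symbols. -/
structure MetricStructure (L : FirstOrder.Language.{a, b}) where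
  carrier : ZFSet.{u}
  metric : MetricSpace carrier
  complete : CompleteSpace carrier
  func : ∀ {n : ℕ}, L.Functions n → (Fin n → carrier) → carrier
  pred : ∀ {n : ℕ}, L.Relations n → (Fin n → carrier) → ℝ
  continuous_func : ∀ {n : ℕ} (F : L.Functions n), Continuous (func F)
  continuous_pred : ∀ {n : ℕ} (R : L.Relations n), Continuous (pred R)

attribute [instance] MetricStructure.metric MetricStructure.complete

namespace MetricStructure

variable {L : FirstOrder.Language.{a, b}}

/-- `M ⊆ N`: the universe of `M` is a subset of that of `N`, and the metric and the
interpretations of all symbols in `M` are the restrictions of those in `N`. -/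
def IsSubstructure (M N : MetricStructure.{u} L) : Prop :=
  ∃ h : M.carrier ⊆ N.carrier,
    (∀ x y : M.carrier, dist x y = dist (⟨x, h x.2⟩ : N.carrier) ⟨y, h y.2⟩) ∧
    (∀ {n : ℕ} (F : L.Functions n) (x : Fin n → M.carrier),
      (M.func F x : ZFSet.{u}) = N.func F fun i => ⟨x i, h (x i).2⟩) ∧
    (∀ {n : ℕ} (R : L.Relations n) (x : Fin n → M.carrier),
      M.pred R x = N.pred R fun i => ⟨x i, h (x i).2⟩)

/-- An isomorphism of metric structures. -/
structure Iso (M N : MetricStructure.{u} L) where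
  toEquiv : M.carrier ≃ N.carrier
  map_dist : ∀ x y, dist (toEquiv x) (toEquiv y) = dist x y
  map_func : ∀ {n : ℕ} (F : L.Functions n) (x : Fin n → M.carrier),
    toEquiv (M.func F x) = N.func F fun i => toEquiv (x i)
  map_pred : ∀ {n : ℕ} (R : L.Relations n) (x : Fin n → M.carrier),
    N.pred R (fun i => toEquiv (x i)) = M.pred R x

/-- `f₁ ⊆ f₂` as maps: `f₂` is defined wherever `f₁` is, and they agree there. -/
def Iso.Extends {M₁ N₁ M₂ N₂ : MetricStructure.{u} L} (f₁ : N₁.Iso M₁) (f₂ : N₂.Iso M₂) : Prop :=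
  ∀ x : N₁.carrier, ∃ h : (x : ZFSet.{u}) ∈ N₂.carrier,
    (f₂.toEquiv ⟨x, h⟩ : ZFSet.{u}) = f₁.toEquiv x

/-- The density character: the least cardinality of a dense subset. -/
noncomputable def dens (M : MetricStructure.{u} L) : Cardinal.{u + 1} :=
  sInf {c | ∃ s : Set M.carrier, Dense s ∧ Cardinal.mk s = c}

/-- `U` is the completion of the union of the structures `M i`: a (complete) metric structure that
has every `M i` as a substructure and in which the union of the `M i` is dense. -/
def IsCompletionOfUnion {ι : Type u} (M : ι → MetricStructure.{u} L)
    (U : MetricStructure.{u} L) : Prop :=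
  (∀ i, (M i).IsSubstructure U) ∧
    Dense {x : U.carrier | ∃ i, (x : ZFSet.{u}) ∈ (M i).carrier}

end MetricStructure

open MetricStructure

variable {L : FirstOrder.Language.{a, b}}

/-- `κ` is a cardinal as in the downward Löwenheim-Skolem axiom. (It is a cardinal of the
set-theoretic universe, not the size of a proper class.) -/
def IsLSCardinal (K : Set (MetricStructure.{u} L))
    (prec : MetricStructure.{u} L → MetricStructure.{u} L → Prop) (κ : Cardinal.{u}) : Prop :=
  Cardinal.aleph0 + Cardinal.lift.{u} L.card ≤ Cardinal.lift.{max a b} κ ∧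
  ∀ M ∈ K, ∀ A : Set ZFSet.{u}, (∀ x ∈ A, x ∈ M.carrier) →
    ∃ N ∈ K, prec N M ∧ (∀ x ∈ A, x ∈ N.carrier) ∧
      N.dens ≤ Cardinal.mk A + Cardinal.lift.{u + 1} κ

/-- `LS(K)`: the least cardinal as in the downward Löwenheim-Skolem axiom. -/
noncomputable def lsNumber (K : Set (MetricStructure.{u} L))
    (prec : MetricStructure.{u} L → MetricStructure.{u} L → Prop) : Cardinal.{u} :=
  sInf {κ | IsLSCardinal K prec κ}

/-- `(K, prec)` is a metric abstract elementary class. -/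
structure IsMAEC (K : Set (MetricStructure.{u} L))
    (prec : MetricStructure.{u} L → MetricStructure.{u} L → Prop) : Prop where
  /-- `prec` is a relation on `K`, and a partial order there -/
  mem_of_prec : ∀ M N, prec M N → M ∈ K ∧ N ∈ K
  refl : ∀ M ∈ K, prec M M
  trans : ∀ M N P, prec M N → prec N P → prec M P
  antisymm : ∀ M N, prec M N → prec N M → M = N
  /-- closure under isomorphism -/
  mem_of_iso : ∀ M N : MetricStructure.{u} L, M ∈ K → Nonempty (M.Iso N) → N ∈ K
  prec_of_iso : ∀ N₁ ∈ K, ∀ N₂ ∈ K, ∀ M₁ ∈ K, ∀ M₂ ∈ K,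
    ∀ (f₁ : N₁.Iso M₁) (f₂ : N₂.Iso M₂), f₁.Extends f₂ → prec N₁ N₂ → prec M₁ M₂
  isSubstructure_of_prec : ∀ M ∈ K, ∀ N ∈ K, prec M N → M.IsSubstructure N
  /-- coherence -/
  coherence : ∀ M N P : MetricStructure.{u} L,
    M.IsSubstructure N → prec M P → prec N P → prec M N
  /-- downward Löwenheim-Skolem -/
  exists_isLSCardinal : ∃ κ : Cardinal.{u}, IsLSCardinal K prec κ
  /-- Tarski-Vaught chain, inside a member of `K` -/
  chain_below : ∀ (ι : Type u) [LinearOrder ι] [WellFoundedLT ι] [Nonempty ι]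
    (N : MetricStructure.{u} L) (M : ι → MetricStructure.{u} L),
    N ∈ K → (∀ i, M i ∈ K) → (∀ i, prec (M i) N) → (∀ i j, i < j → prec (M i) (M j)) →
    (∃ U : MetricStructure.{u} L, U.IsSubstructure N ∧ IsCompletionOfUnion M U) ∧
    ∀ U : MetricStructure.{u} L, U.IsSubstructure N → IsCompletionOfUnion M U →
      U ∈ K ∧ prec U N
  /-- Tarski-Vaught chain -/
  chain : ∀ (ι : Type u) [LinearOrder ι] [WellFoundedLT ι] [Nonempty ι]
    (M : ι → MetricStructure.{u} L),
    (∀ i, M i ∈ K) → (∀ i j, i < j → prec (M i) (M j)) →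
    (∃ U : MetricStructure.{u} L, IsCompletionOfUnion M U) ∧
    ∀ U : MetricStructure.{u} L, IsCompletionOfUnion M U → U ∈ K ∧ ∀ j, prec (M j) U

end MAEC

/-! ### Hilbert space operator structures and the class of `Q` -/

section Hilbert

/-- The function symbols `0`, `-`, `i`, `I_r` (`r` rational) and `+`. -/
inductive HilbertFunc : ℕ → Type
  | zero : HilbertFunc 0
  | neg : HilbertFunc 1
  | mulI : HilbertFunc 1
  | ratMul (r : ℚ) : HilbertFunc 1
  | add : HilbertFunc 2

/-- The predicate symbols `‖·‖` and `Γ`. -/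
inductive HilbertPred : ℕ → Type
  | norm : HilbertPred 1
  | graph : HilbertPred 2

/-- The similarity type `(0, -, i, +, (I_r), ‖·‖, Γ)`. -/
def hilbertLanguage : FirstOrder.Language.{0, 0} := ⟨HilbertFunc, HilbertPred⟩

/-- A complex Hilbert space, whose underlying set is a set of the set-theoretic universe, with a
self-adjoint operator on it, possibly unbounded. (In Mathlib, a self-adjoint partially defined
operator is automatically densely defined and closed.) -/
structure HilbertOperator where
  carrier : ZFSet.{u}
  normed : NormedAddCommGroup carrier
  inner : InnerProductSpace ℂ carrier
  complete : CompleteSpace carrier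
  op : carrier →ₗ.[ℂ] carrier
  selfAdjoint : IsSelfAdjoint op

attribute [instance] HilbertOperator.normed HilbertOperator.inner HilbertOperator.complete

namespace HilbertOperator

/-- The interpretations of the function symbols. -/
noncomputable def func (X : HilbertOperator.{u}) :
    ∀ {n : ℕ}, HilbertFunc n → (Fin n → X.carrier) → X.carrier
  | _, .zero, _ => 0
  | _, .neg, x => - x 0
  | _, .mulI, x => Complex.I • x 0
  | _, .ratMul r, x => (r : ℂ) • x 0
  | _, .add, x => x 0 + x 1

/-- The interpretations of the predicate symbols. -/
noncomputable def pred (X : HilbertOperator.{u}) :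
    ∀ {n : ℕ}, HilbertPred n → (Fin n → X.carrier) → ℝ
  | _, .norm, x => ‖x 0‖
  | _, .graph, x => graphDist X.op (x 0) (x 1)

theorem continuous_func (X : HilbertOperator.{u}) {n : ℕ} (F : HilbertFunc n) :
    Continuous (X.func F) :=
  match n, F with
  | _, .zero => continuous_const
  | _, .neg => (continuous_apply (0 : Fin 1)).neg
  | _, .mulI => (continuous_apply (0 : Fin 1)).const_smul Complex.I
  | _, .ratMul r => (continuous_apply (0 : Fin 1)).const_smul (r : ℂ)
  | _, .add => (continuous_apply (0 : Fin 2)).add (continuous_apply (1 : Fin 2))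

theorem continuous_pred (X : HilbertOperator.{u}) {n : ℕ} (R : HilbertPred n) :
    Continuous (X.pred R) :=
  match n, R with
  | _, .norm => (continuous_apply (0 : Fin 1)).norm
  | _, .graph => continuous_graphDist X.op

/-- The Hilbert space operator structure `(H, 0, -, i, +, (I_r), ‖·‖, Γ_Q)`. -/
noncomputable def toMetricStructure (X : HilbertOperator.{u}) :
    MetricStructure.{u} hilbertLanguage where
  carrier := X.carrier
  metric := inferInstance
  complete := X.complete
  func := X.func
  pred := X.pred
  continuous_func := X.continuous_func
  continuous_pred := X.continuous_pred

/-- `H₁ ⊆ H₂` and `Q₁ ⊆ Q₂`: the first Hilbert space is a Hilbert subspace of the second, that is,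
a subset such that the inclusion is linear and isometric, and the graph of the first operator is
contained in the graph of the second. -/
def IsSubOperator (X Y : HilbertOperator.{u}) : Prop :=
  ∃ e : X.carrier →ₗᵢ[ℂ] Y.carrier, (∀ x, (e x : ZFSet.{u}) = x) ∧
    ∀ x y, (x, y) ∈ X.op.graph → (e x, e y) ∈ Y.op.graph

end HilbertOperator

variable {H : Type v} [NormedAddCommGroup H] [InnerProductSpace ℂ H]

/-- The class `K_(H, Γ_Q)`. -/
def KClass (Q : H →ₗ.[ℂ] H) : Set (MetricStructure.{u} hilbertLanguage) :=
  {M | ∃ X : HilbertOperator.{u}, X.toMetricStructure = M ∧ SpectrallyEquivalent X.op Q}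

/-- The relation of `K_(H, Γ_Q)`. -/
def KPrec (Q : H →ₗ.[ℂ] H) (M N : MetricStructure.{u} hilbertLanguage) : Prop :=
  M ∈ KClass Q ∧ N ∈ KClass Q ∧
    ∃ X Y : HilbertOperator.{u}, X.toMetricStructure = M ∧ Y.toMetricStructure = N ∧
      X.IsSubOperator Y

end Hilbert

end SpectralMAEC

namespace SpectralMAEC

open scoped InnerProductSpace Cardinal
open Filter Topology

/-! ### Self-adjointness as a property of the graph -/

section SelfAdjoint

variable {H : Type v} [NormedAddCommGroup H] [InnerProductSpace ℂ H] {Q : H →ₗ.[ℂ] H}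

/-! Call `l` a Fredholm point of a self-adjoint operator `Q` if the eigenspace at `l` is
finite-dimensional and `Q - l` is bounded below on its orthogonal complement. The essential spectrum
is the set of non-Fredholm points (`mem_essentialSpectrum_iff`), and the resolvent set consists of
the Fredholm points with trivial eigenspace. Hence spectral equivalence means: same Fredholm points,
same eigenspace dimensions there (`spectrallyEquivalent_iff`).

If `Q₁ ⊆ Q₂` are both self-adjoint, then the smaller space reduces `Q₂`: the orthogonal projection
maps the graph of `Q₂` into that of `Q₁` (`MapsGraph.coproj_mem_graph`). So `Γ` restricts correctly.
Conversely, the zero set of `Γ` is the graph, and the other symbols recover the Hilbert space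
structure. Inside the class, the order is therefore just the substructure relation (`kPrec_iff`),
which gives the order axioms, invariance under isomorphism and coherence.

For chains, the limit operator lives on the completed direct limit; its graph consists of the pairs
all of whose projections lie in the given graphs. At a Fredholm point the finite dimension is
constant along the chain, so no new eigenvectors appear. The lower bound off the eigenspace survives
because it is uniform: it can be taken to be the distance to the rest of the spectrum, which is
common to the whole chain (`IsFredholmAt.mul_norm_le`). Completions of the union are unique up to
isomorphism, so all of them are in the class.

For Löwenheim–Skolem, each complex `l` needs at most continuum many witnesses of its spectral type.
Adding them to the given set and closing under the resolvents at `±i` yields a reducing subspace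
with the same spectral data; hence the continuum is a Löwenheim–Skolem cardinal. -/

theorem mem_eigenspace_iff {l : ℂ} {x : H} : x ∈ eigenspace Q l ↔ (x, l • x) ∈ Q.graph := by
  simp only [eigenspace, Submodule.mem_map, LinearMap.mem_ker, LinearPMap.mem_graph_iff]
  constructor
  · rintro ⟨y, hy, rfl⟩
    exact ⟨y, rfl, by simpa [shift, sub_eq_zero] using hy⟩
  · rintro ⟨y, rfl, hy⟩
    refine ⟨y, ?_, rfl⟩
    simpa [shift, sub_eq_zero] using hy

theorem isSelfAdjoint_of_graph [CompleteSpace H] (hd : Dense (Q.domain : Set H))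
    (h : ∀ u v, (u, v) ∈ Q.graph ↔ ∀ x y, (x, y) ∈ Q.graph → ⟪y, u⟫_ℂ = ⟪x, v⟫_ℂ) :
    IsSelfAdjoint Q := by
  rw [LinearPMap.isSelfAdjoint_def]
  apply LinearPMap.eq_of_eq_graph
  rw [LinearPMap.adjoint_graph_eq_graph_adjoint hd]
  ext ⟨x, y⟩
  rw [Submodule.mem_adjoint_iff, h]
  simp only [sub_eq_zero]

variable [CompleteSpace H]

theorem mem_graph_iff_of_isSelfAdjoint (hQ : IsSelfAdjoint Q) {u v : H} :
    (u, v) ∈ Q.graph ↔ ∀ x y, (x, y) ∈ Q.graph → ⟪y, u⟫_ℂ = ⟪x, v⟫_ℂ := by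
  have h := LinearPMap.adjoint_graph_eq_graph_adjoint hQ.dense_domain
  rw [LinearPMap.isSelfAdjoint_def.1 hQ] at h
  rw [h, Submodule.mem_adjoint_iff, ← h]
  simp only [sub_eq_zero]

theorem inner_graph_comm (hQ : IsSelfAdjoint Q) {x y u v : H} (h : (x, y) ∈ Q.graph)
    (h' : (u, v) ∈ Q.graph) : ⟪y, u⟫_ℂ = ⟪x, v⟫_ℂ :=
  (mem_graph_iff_of_isSelfAdjoint hQ).1 h' x y h

/-- A bounded perturbation `Q + B` of a self-adjoint operator that is bounded below and whose
formal adjoint `Q + B†` is injective has a bounded everywhere defined inverse. -/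
theorem exists_bounded_inverse (hQ : IsSelfAdjoint Q) (B : H →L[ℂ] H)
    (hb : ∃ C : ℝ, ∀ x y, (x, y) ∈ Q.graph → ‖x‖ ≤ C * ‖y + B x‖)
    (hi : ∀ x y, (x, y) ∈ Q.graph → y + ContinuousLinearMap.adjoint B x = 0 → x = 0) :
    ∃ S : H →L[ℂ] H, (∀ v, (S v, v - B (S v)) ∈ Q.graph) ∧
      ∀ x y, (x, y) ∈ Q.graph → S (y + B x) = x := by
  obtain ⟨C, hC⟩ := hb
  have hcl : IsClosed (Q.graph : Set (H × H)) := hQ.isClosed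
  have : CompleteSpace Q.graph := hcl.completeSpace_coe
  -- The graph is a Banach space, so `Q + B` becomes a bounded operator on it; bounded below means
  -- closed range, and only density of the range remains.
  let g : Q.graph →L[ℂ] H :=
    (ContinuousLinearMap.snd ℂ H H + B.comp (ContinuousLinearMap.fst ℂ H H)).comp Q.graph.subtypeL
  have hg : ∀ p : Q.graph, g p = p.1.2 + B p.1.1 := fun p => rfl
  have hbound : ∀ p : Q.graph, ‖p‖ ≤ (Real.toNNReal (|C| + 1 + ‖B‖ * |C|) : ℝ) * ‖g p‖ := by
    intro p
    have h1 : ‖p.1.1‖ ≤ |C| * ‖g p‖ :=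
      (hC p.1.1 p.1.2 p.2).trans (mul_le_mul_of_nonneg_right (le_abs_self C) (norm_nonneg _))
    have h2 : ‖p.1.2‖ ≤ ‖g p‖ + ‖B‖ * (|C| * ‖g p‖) := by
      have : p.1.2 = g p - B p.1.1 := by rw [hg]; abel
      calc ‖p.1.2‖ ≤ ‖g p‖ + ‖B p.1.1‖ := by rw [this]; exact norm_sub_le _ _
        _ ≤ _ := by
          have := (B.le_opNorm p.1.1).trans (mul_le_mul_of_nonneg_left h1 (norm_nonneg _))
          linarith
    rw [Real.coe_toNNReal _ (by positivity)]
    have h3 : ‖p‖ = max ‖p.1.1‖ ‖p.1.2‖ := rfl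
    rw [h3]
    have h4 : 0 ≤ ‖B‖ * (|C| * ‖g p‖) := by positivity
    have h5 : 0 ≤ |C| * ‖g p‖ := by positivity
    have h6 : 0 ≤ ‖g p‖ := norm_nonneg _
    apply max_le <;> nlinarith
  have hal := g.antilipschitz_of_bound hbound
  have hrange : g.range = ⊤ := by
    have hc : IsClosed (g.range : Set H) := by
      rw [show (g.range : Set H) = Set.range g from LinearMap.coe_range _]
      exact hal.isClosed_range g.uniformContinuous
    have : CompleteSpace g.range := hc.completeSpace_coe
    rw [← Submodule.orthogonal_eq_bot_iff, Submodule.eq_bot_iff]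
    intro z hz
    rw [Submodule.mem_orthogonal] at hz
    -- A vector orthogonal to the range of `Q + B` lies in the kernel of its adjoint `Q + B†`.
    have hz' : (z, -ContinuousLinearMap.adjoint B z) ∈ Q.graph := by
      rw [mem_graph_iff_of_isSelfAdjoint hQ]
      intro x y hxy
      have := hz (g ⟨(x, y), hxy⟩) ⟨_, rfl⟩
      rw [hg, inner_add_left] at this
      rw [inner_neg_right, ContinuousLinearMap.adjoint_inner_right]
      exact eq_neg_of_add_eq_zero_left this
    exact hi _ _ hz' (by simp)
  let e := ContinuousLinearEquiv.ofBijective g (LinearMap.ker_eq_bot.2 hal.injective) hrange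
  have he : ∀ p, e p = g p := fun p => rfl
  refine ⟨(ContinuousLinearMap.fst ℂ H H).comp (Q.graph.subtypeL.comp e.symm.toContinuousLinearMap),
    fun v => ?_, fun x y hxy => ?_⟩
  · have h1 : g (e.symm v) = v := e.apply_symm_apply v
    rw [hg] at h1
    have h2 := (e.symm v).2
    have h3 : v - B (e.symm v).1.1 = (e.symm v).1.2 := by rw [sub_eq_iff_eq_add]; exact h1.symm
    change ((e.symm v).1.1, v - B (e.symm v).1.1) ∈ Q.graph
    rw [h3]; exact h2
  · have h1 : y + B x = e ⟨(x, y), hxy⟩ := rfl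
    change (e.symm (y + B x)).1.1 = x
    rw [h1, e.symm_apply_apply]

end SelfAdjoint

/-! ### Resolvents and the spectrum -/

section Resolvent

variable {H : Type v} [NormedAddCommGroup H] [InnerProductSpace ℂ H] {Q : H →ₗ.[ℂ] H}

/-- `Q - l I` has a bounded inverse on its range. -/
def IsBoundedBelowAt (Q : H →ₗ.[ℂ] H) (l : ℂ) : Prop :=
  ∃ C : ℝ, ∀ x y, (x, y) ∈ Q.graph → ‖x‖ ≤ C * ‖y - l • x‖

theorem isBoundedBelowAt_of_le {l : ℂ} {c : ℝ} (hc : 0 < c)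
    (h : ∀ x y, (x, y) ∈ Q.graph → c * ‖x‖ ≤ ‖y - l • x‖) : IsBoundedBelowAt Q l :=
  ⟨c⁻¹, fun x y hxy => (le_inv_mul_iff₀ hc).2 (h x y hxy)⟩

theorem IsBoundedBelowAt.eq_zero {l : ℂ} (h : IsBoundedBelowAt Q l) {x : H}
    (hx : (x, l • x) ∈ Q.graph) : x = 0 := by
  obtain ⟨C, hC⟩ := h
  simpa using hC _ _ hx

variable [CompleteSpace H]

/-- Since `⟪x, y⟫` is real, the imaginary part of `⟪x, y - l • x⟫` is `-l.im * ‖x‖ ^ 2`;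
Cauchy–Schwarz does the rest. -/
theorem abs_im_mul_norm_le (hQ : IsSelfAdjoint Q) (l : ℂ) {x y : H} (h : (x, y) ∈ Q.graph) :
    |l.im| * ‖x‖ ≤ ‖y - l • x‖ := by
  have h1 : (⟪x, y⟫_ℂ).im = 0 := by
    have h2 := inner_graph_comm hQ h h
    rw [← inner_conj_symm] at h2
    exact Complex.conj_eq_iff_im.1 h2
  have h3 : (⟪x, y - l • x⟫_ℂ).im = -(l.im * ‖x‖ ^ 2) := by
    rw [inner_sub_right, inner_smul_right, inner_self_eq_norm_sq_to_K, Complex.sub_im, h1,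
      zero_sub, ← Complex.im_mul_ofReal, Complex.ofReal_pow]
    rfl
  have h4 : |l.im| * ‖x‖ ^ 2 ≤ ‖x‖ * ‖y - l • x‖ := by
    have := (Complex.abs_im_le_norm _).trans (norm_inner_le_norm (𝕜 := ℂ) x (y - l • x))
    rwa [h3, abs_neg, abs_mul, abs_of_nonneg (sq_nonneg ‖x‖)] at this
  rcases (norm_nonneg x).eq_or_lt with h0 | h0
  · rw [← h0, mul_zero]; exact norm_nonneg _
  · nlinarith

theorem isBoundedBelowAt_of_im_ne_zero (hQ : IsSelfAdjoint Q) {l : ℂ} (hl : l.im ≠ 0) :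
    IsBoundedBelowAt Q l :=
  isBoundedBelowAt_of_le (abs_pos.2 hl) fun _ _ h => abs_im_mul_norm_le hQ l h

/-- The adjoint of `Q - l` is `Q - conj l`, which is bounded below too: for real `l` it is the same
operator, for nonreal `l` this is automatic. -/
theorem exists_resolvent (hQ : IsSelfAdjoint Q) {l : ℂ} (h : IsBoundedBelowAt Q l) :
    ∃ R : H →L[ℂ] H, (∀ v, (R v, v + l • R v) ∈ Q.graph) ∧
      ∀ x y, (x, y) ∈ Q.graph → R (y - l • x) = x := by
  have h' : IsBoundedBelowAt Q (starRingEnd ℂ l) := by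
    by_cases hl : l.im = 0
    · rwa [Complex.conj_eq_iff_im.2 hl]
    · exact isBoundedBelowAt_of_im_ne_zero hQ (by simpa using hl)
  obtain ⟨S, hS, hS'⟩ := exists_bounded_inverse hQ (-(l • ContinuousLinearMap.id ℂ H))
    (by simpa [sub_eq_add_neg, IsBoundedBelowAt] using h) (by
      intro x y hxy h0
      refine h'.eq_zero (?_ : (x, starRingEnd ℂ l • x) ∈ Q.graph)
      have : y = starRingEnd ℂ l • x := by
        rw [map_neg, map_smulₛₗ, ContinuousLinearMap.adjoint_id] at h0
        simpa [← sub_eq_add_neg, sub_eq_zero] using h0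
      rwa [← this])
  exact ⟨S, by simpa using hS, by simpa [sub_eq_add_neg] using hS'⟩

/-- Boundedness below gives injectivity and, through the resolvent, surjectivity, so it excludes all
three kinds of spectrum at once. -/
theorem mem_operatorSpectrum_iff (hQ : IsSelfAdjoint Q) {l : ℂ} :
    l ∈ operatorSpectrum Q ↔ ¬ IsBoundedBelowAt Q l := by
  have hBB : IsBoundedBelowAt Q l ↔
      ∃ C : ℝ, ∀ v : Q.domain, ‖(v : H)‖ ≤ C * ‖shift Q l v‖ := by
    refine exists_congr fun C => ⟨fun h v => h _ _ (Q.mem_graph v), fun h x y hxy => ?_⟩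
    obtain ⟨v, rfl, rfl⟩ := (LinearPMap.mem_graph_iff Q).1 hxy
    exact h v
  rw [← not_iff_not, not_not, operatorSpectrum, Set.mem_union, Set.mem_union, pointSpectrum,
    continuousSpectrum, residualSpectrum]
  simp only [Set.mem_ofPred_eq, ← hBB]
  constructor
  · intro h
    tauto
  · intro h
    have h1 : Function.Injective (shift Q l) := by
      rw [injective_iff_map_eq_zero]
      intro v hv
      obtain ⟨C, hC⟩ := hBB.1 h
      simpa [hv] using hC v
    have h2 : DenseRange (shift Q l) := by
      obtain ⟨R, hR, -⟩ := exists_resolvent hQ h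
      apply Function.Surjective.denseRange
      intro v
      obtain ⟨w, hw, hw'⟩ := (LinearPMap.mem_graph_iff Q).1 (hR v)
      refine ⟨w, ?_⟩
      change Q w - l • (w : H) = v
      rw [hw, hw']; simp
    tauto

/-- If `Q - m I` is boundedly invertible for all real `m` at distance less than `d` from `l`, then
the inverse of `Q - l I` has norm at most `1 / d`. -/
theorem mul_norm_le_of_forall_isBoundedBelowAt (hQ : IsSelfAdjoint Q) {l d : ℝ} (hd : 0 < d)
    (h : ∀ m : ℝ, |m - l| < d → IsBoundedBelowAt Q m) {x y : H} (hxy : (x, y) ∈ Q.graph) :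
    d * ‖x‖ ≤ ‖y - (l : ℂ) • x‖ := by
  obtain ⟨R, hR, hR'⟩ := exists_resolvent hQ (h l (by simpa using hd))
  suffices hn : ‖R‖ ≤ d⁻¹ by
    rw [← le_inv_mul_iff₀ hd]
    have := R.le_of_opNorm_le hn (y - (l : ℂ) • x)
    rwa [hR' x y hxy] at this
  by_contra! hn
  have hsym : IsSelfAdjoint R := by
    rw [ContinuousLinearMap.isSelfAdjoint_iff_isSymmetric]
    intro u v
    have := inner_graph_comm hQ (hR u) (hR v)
    rw [inner_add_left, inner_add_right, inner_smul_left, inner_smul_right, Complex.conj_ofReal]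
      at this
    exact (add_right_cancel this).symm
  have hpos : 0 < ‖R‖ := (inv_pos.2 hd).trans hn
  have : Nontrivial (H →L[ℂ] H) := ⟨R, 0, norm_pos_iff.1 hpos⟩
  -- For the self-adjoint `R` the spectral radius equals the norm, so some real spectral value `t`
  -- has `|t| = ‖R‖ > d⁻¹`.
  obtain ⟨k, hk, hkn⟩ := spectrum.exists_nnnorm_eq_spectralRadius R
  rw [hsym.spectralRadius_eq_nnnorm, ENNReal.coe_inj] at hkn
  have hkn' : ‖k‖ = ‖R‖ := congrArg NNReal.toReal hkn
  have hkr : k = (k.re : ℂ) := hsym.mem_spectrum_eq_re hk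
  set t : ℝ := k.re with ht
  have htn : |t| = ‖R‖ := by rw [← hkn', hkr, Complex.norm_real, Real.norm_eq_abs]
  have ht0 : t ≠ 0 := by rw [← abs_pos, htn]; exact hpos
  -- Formally `t - R = t (Q - (l + t⁻¹)) (Q - l)⁻¹`, and `l + t⁻¹` is within `d` of `l`. The
  -- resolvent `S` there thus yields an inverse of `t - R`, contradicting the choice of `t`.
  obtain ⟨S, hS, hS'⟩ := exists_resolvent hQ (h (l + t⁻¹) (by
    rw [add_sub_cancel_left, abs_inv, htn]; exact inv_lt_of_inv_lt₀ hd hn))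
  have htc : (t : ℂ) ≠ 0 := by exact_mod_cast ht0
  have h1 : ∀ v, S v - R v = (t : ℂ)⁻¹ • R (S v) := by
    intro v
    have := hR' _ _ (hS v)
    rw [Complex.ofReal_add, add_smul, ← add_assoc, add_sub_right_comm, add_sub_cancel_right,
      map_add, Complex.ofReal_inv, map_smul] at this
    rw [sub_eq_iff_eq_add, add_comm, this]
  have h2 : ∀ v, S v - R v = (t : ℂ)⁻¹ • S (R v) := by
    intro v
    have := hS' _ _ (hR v)
    rw [Complex.ofReal_add, add_smul, ← sub_sub, add_sub_cancel_right, map_sub, Complex.ofReal_inv,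
      map_smul] at this
    nth_rewrite 1 [← this]
    abel
  rw [spectrum.mem_iff] at hk
  apply hk
  rw [hkr]
  have e1 : ∀ v, (algebraMap ℂ (H →L[ℂ] H) t - R) v = (t : ℂ) • v - R v := by
    intro v; simp [Algebra.algebraMap_eq_smul_one]
  refine ⟨⟨algebraMap ℂ (H →L[ℂ] H) t - R,
    (t : ℂ)⁻¹ • (1 + (t : ℂ)⁻¹ • S), ?_, ?_⟩, rfl⟩
  · ext v
    rw [mul_apply_eq_comp, e1]
    simp only [smul_apply, add_apply,
      one_apply_eq_self, map_smul, map_add, smul_smul, mul_inv_cancel₀ htc, one_smul]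
    linear_combination (norm := module) (t : ℂ)⁻¹ • h1 v
  · ext v
    rw [mul_apply_eq_comp, e1]
    simp only [smul_apply, add_apply,
      one_apply_eq_self, map_smul, map_sub, smul_smul, mul_inv_cancel₀ htc, one_smul]
    linear_combination (norm := module) (t : ℂ)⁻¹ • h2 v

end Resolvent

/-! ### Fredholm points and the essential spectrum -/

section Fredholm

variable {H : Type v} [NormedAddCommGroup H] [InnerProductSpace ℂ H] {Q : H →ₗ.[ℂ] H}

/-- The eigenspace at `l` is finite-dimensional, and `Q - l I` is bounded below on its orthogonal
complement. -/
def IsFredholmAt (Q : H →ₗ.[ℂ] H) (l : ℂ) : Prop :=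
  FiniteDimensional ℂ (eigenspace Q l) ∧
    ∃ C : ℝ, ∀ x y, (x, y) ∈ Q.graph → x ∈ (eigenspace Q l)ᗮ → ‖x‖ ≤ C * ‖y - l • x‖

theorem IsBoundedBelowAt.eigenspace_eq_bot {l : ℂ} (h : IsBoundedBelowAt Q l) :
    eigenspace Q l = ⊥ :=
  (Submodule.eq_bot_iff _).2 fun _ hx => h.eq_zero (mem_eigenspace_iff.1 hx)

theorem IsBoundedBelowAt.isFredholmAt {l : ℂ} (h : IsBoundedBelowAt Q l) : IsFredholmAt Q l := by
  refine ⟨?_, ?_⟩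
  · rw [h.eigenspace_eq_bot]; infer_instance
  · obtain ⟨C, hC⟩ := h
    exact ⟨C, fun x y hxy _ => hC x y hxy⟩

theorem isBoundedBelowAt_iff {l : ℂ} :
    IsBoundedBelowAt Q l ↔ IsFredholmAt Q l ∧ eigenspace Q l = ⊥ := by
  refine ⟨fun h => ⟨h.isFredholmAt, h.eigenspace_eq_bot⟩, ?_⟩
  rintro ⟨⟨-, C, hC⟩, h⟩
  exact ⟨C, fun x y hxy => hC x y hxy (by simp [h])⟩

theorem sub_mem_graph {l : ℂ} {x y a : H} (hxy : (x, y) ∈ Q.graph) (ha : a ∈ eigenspace Q l) :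
    (x - a, y - l • a) ∈ Q.graph :=
  Q.graph.sub_mem hxy (mem_eigenspace_iff.1 ha)

theorem norm_smul_add_sq {a w : H} (h : ⟪a, w⟫_ℂ = 0) (m : ℂ) :
    ‖m • a + w‖ ^ 2 = (‖m‖ * ‖a‖) ^ 2 + ‖w‖ ^ 2 := by
  rw [pow_two, norm_add_sq_eq_norm_sq_add_norm_sq_of_inner_eq_zero _ _
    (by rw [inner_smul_left, h, mul_zero]), norm_smul]
  ring

theorem IsFredholmAt.exists_pos {l : ℂ} (h : IsFredholmAt Q l) : ∃ c : ℝ, 0 < c ∧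
    ∀ x y, (x, y) ∈ Q.graph → x ∈ (eigenspace Q l)ᗮ → c * ‖x‖ ≤ ‖y - l • x‖ := by
  obtain ⟨-, C, hC⟩ := h
  refine ⟨(|C| + 1)⁻¹, by positivity, fun x y hxy hx => ?_⟩
  rw [inv_mul_le_iff₀ (by positivity)]
  exact (hC x y hxy hx).trans
    (mul_le_mul_of_nonneg_right ((le_abs_self C).trans (by linarith)) (norm_nonneg _))

/-- A bounded sequence has a subsequence along which the adjoint of a given compact operator
converges. -/
theorem exists_subseq_tendsto_adjoint [CompleteSpace H] {K : H →L[ℂ] H} (hK : IsCompactOperator K)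
    {x : ℕ → H} {M : ℝ} (hM : ∀ n, ‖x n‖ ≤ M) :
    ∃ (z : H) (φ : ℕ → ℕ), StrictMono φ ∧
      Tendsto (fun n => ContinuousLinearMap.adjoint K (x (φ n))) atTop (𝓝 z) := by
  set A := ContinuousLinearMap.adjoint K
  -- `K K†` is compact, and `‖K† d‖ ^ 2 = ⟪K K† d, d⟫` transfers convergence along a bounded
  -- sequence from `K K†` to `K†`.
  have hc : IsCompactOperator (K.comp A) := hK.comp_clm A
  obtain ⟨s, hs, hsub⟩ := hc.image_closedBall_subset_compact (f := (K.comp A : H →ₗ[ℂ] H)) M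
  obtain ⟨w, -, φ, hφ, hw⟩ := hs.tendsto_subseq (x := fun n => K (A (x n)))
    (fun n => hsub ⟨x n, by simpa using hM n, rfl⟩)
  have hcau : CauchySeq fun n => A (x (φ n)) := by
    have hw' := hw.cauchySeq
    rw [Metric.cauchySeq_iff] at hw' ⊢
    intro ε hε
    have hM0 : 0 ≤ M := (norm_nonneg _).trans (hM 0)
    obtain ⟨N, hN⟩ := hw' (ε ^ 2 / (2 * M + 1)) (by positivity)
    refine ⟨N, fun m hm n hn => ?_⟩
    have h1 := hN m hm n hn
    simp only [Function.comp, dist_eq_norm, ← map_sub] at h1 ⊢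
    set d := x (φ m) - x (φ n)
    have hd : ‖d‖ ≤ 2 * M := (norm_sub_le _ _).trans (by linarith [hM (φ m), hM (φ n)])
    have h2 : ‖A d‖ ^ 2 ≤ ‖K (A d)‖ * ‖d‖ := by
      have h3 : ⟪K (A d), d⟫_ℂ = ⟪A d, A d⟫_ℂ :=
        (ContinuousLinearMap.adjoint_inner_right K (A d) d).symm
      have := norm_inner_le_norm (𝕜 := ℂ) (K (A d)) d
      rw [h3, inner_self_eq_norm_sq_to_K] at this
      simpa using this
    rw [lt_div_iff₀ (by positivity)] at h1
    have h4 : ‖A d‖ ^ 2 < ε ^ 2 := by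
      nlinarith [norm_nonneg (K (A d)), norm_nonneg d]
    exact lt_of_pow_lt_pow_left₀ 2 hε.le h4
  obtain ⟨z, hz⟩ := cauchySeq_tendsto_of_complete hcau
  exact ⟨z, φ, hφ, hz⟩

variable [CompleteSpace H]

theorem isClosed_eigenspace (hQ : IsSelfAdjoint Q) (l : ℂ) :
    IsClosed (eigenspace Q l : Set H) := by
  have h : (eigenspace Q l : Set H) = (fun x => (x, l • x)) ⁻¹' (Q.graph : Set (H × H)) := by
    ext x; exact mem_eigenspace_iff
  rw [h]
  exact (hQ.isClosed : IsClosed (Q.graph : Set (H × H))).preimage (by fun_prop)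

theorem inner_eigenspace_eq_zero (hQ : IsSelfAdjoint Q) {l : ℝ} {e x y : H}
    (he : e ∈ eigenspace Q l) (hxy : (x, y) ∈ Q.graph) : ⟪e, y - (l : ℂ) • x⟫_ℂ = 0 := by
  have := inner_graph_comm hQ (mem_eigenspace_iff.1 he) hxy
  rw [inner_smul_left, Complex.conj_ofReal] at this
  rw [inner_sub_right, inner_smul_right, this, sub_self]

theorem exists_eigenspace_decomposition (hQ : IsSelfAdjoint Q) (l : ℂ) (x : H) :
    ∃ a ∈ eigenspace Q l, ∃ b ∈ (eigenspace Q l)ᗮ, x = a + b := by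
  have := (isClosed_eigenspace hQ l).completeSpace_coe
  exact (eigenspace Q l).exists_add_mem_mem_orthogonal x

/-- Adding the projection `P` onto the eigenspace makes `Q - l + P` invertible: it is the identity
on the eigenspace and bounded below on the complement. Its inverse `S` satisfies `(Q - l) S = I - P
S`, and `P S` has finite rank. -/
theorem IsFredholmAt.exists_parametrix (hQ : IsSelfAdjoint Q) {l : ℝ} (h : IsFredholmAt Q l) :
    ∃ S K : H →L[ℂ] H, IsCompactOperator K ∧
      ∀ v, (S v, v + K v + (l : ℂ) • S v) ∈ Q.graph := by
  have := h.1
  set E := eigenspace Q (l : ℂ)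
  obtain ⟨c, hc, hcE⟩ := h.exists_pos
  set B : H →L[ℂ] H := E.starProjection - (l : ℂ) • ContinuousLinearMap.id ℂ H
  have hB : ContinuousLinearMap.adjoint B = B := by
    rw [map_sub, map_smulₛₗ, ContinuousLinearMap.adjoint_id, Complex.conj_ofReal,
      (isSelfAdjoint_starProjection E).adjoint_eq]
  have hbd : ∀ x y, (x, y) ∈ Q.graph → ‖x‖ ≤ (1 + c⁻¹) * ‖y + B x‖ := by
    intro x y hxy
    obtain ⟨a, ha, b, hb, rfl⟩ := exists_eigenspace_decomposition hQ (l : ℂ) x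
    have hP : E.starProjection (a + b) = a := by
      rw [map_add, Submodule.starProjection_eq_self_iff.2 ha,
        (Submodule.starProjection_apply_eq_zero_iff E).2 hb, add_zero]
    have hby : (b, y - (l : ℂ) • a) ∈ Q.graph := by
      simpa using sub_mem_graph hxy ha
    set w := y - (l : ℂ) • a - (l : ℂ) • b
    have h1 : y + B (a + b) = (1 : ℂ) • a + w := by
      simp only [B, sub_apply, smul_apply, ContinuousLinearMap.id_apply, hP, w]
      module
    have h2 := norm_smul_add_sq (inner_eigenspace_eq_zero hQ ha hby) 1
    have h3 := hcE _ _ hby hb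
    rw [h1]
    rw [norm_one, one_mul] at h2
    have h4 : ‖a‖ ≤ ‖(1 : ℂ) • a + w‖ :=
      le_of_sq_le_sq (by nlinarith [sq_nonneg ‖w‖]) (norm_nonneg _)
    have h5 : ‖w‖ ≤ ‖(1 : ℂ) • a + w‖ :=
      le_of_sq_le_sq (by nlinarith [sq_nonneg ‖a‖]) (norm_nonneg _)
    have h6 : ‖b‖ ≤ c⁻¹ * ‖(1 : ℂ) • a + w‖ := by
      rw [le_inv_mul_iff₀ hc]; exact h3.trans h5
    linarith [norm_add_le a b]
  obtain ⟨S, hS, -⟩ := exists_bounded_inverse hQ B ⟨_, hbd⟩ (by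
    intro x y hxy h0
    rw [hB] at h0
    simpa [h0] using hbd x y hxy)
  refine ⟨S, -(E.starProjection.comp S), ?_, fun v => ?_⟩
  · have : IsCompactOperator E.starProjection :=
      (isCompactOperator_of_locallyCompactSpace_dom
        E.orthogonalProjectionOnto).clm_comp E.subtypeL
    exact (this.comp_clm S).neg
  · convert hS v using 2
    simp only [B, sub_apply, smul_apply, ContinuousLinearMap.id_apply, neg_apply,
      ContinuousLinearMap.comp_apply]
    module

/-- In the presence of a parametrix, approximate eigenvectors accumulate at eigenvectors. -/
theorem exists_subseq_tendsto_eigenspace (hQ : IsSelfAdjoint Q) {l : ℝ} {S K : H →L[ℂ] H}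
    (hK : IsCompactOperator K) (hSK : ∀ v, (S v, v + K v + (l : ℂ) • S v) ∈ Q.graph)
    {x y : ℕ → H} {M : ℝ} (hM : ∀ n, ‖x n‖ ≤ M) (hxy : ∀ n, (x n, y n) ∈ Q.graph)
    (h0 : Tendsto (fun n => y n - (l : ℂ) • x n) atTop (𝓝 0)) :
    ∃ z ∈ eigenspace Q l, ∃ φ : ℕ → ℕ, StrictMono φ ∧
      Tendsto (fun n => x (φ n)) atTop (𝓝 z) := by
  obtain ⟨z, φ, hφ, hz⟩ := exists_subseq_tendsto_adjoint hK hM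
  -- This is the adjoint of `(Q - l) S = I + K`: on the domain of `Q`, `S† (Q - l) = I + K†`.
  have key : ∀ n, x n = ContinuousLinearMap.adjoint S (y n - (l : ℂ) • x n) -
      ContinuousLinearMap.adjoint K (x n) := by
    intro n
    refine ext_inner_right ℂ fun v => ?_
    have := inner_graph_comm hQ (hxy n) (hSK v)
    rw [inner_sub_left, ContinuousLinearMap.adjoint_inner_left,
      ContinuousLinearMap.adjoint_inner_left, inner_sub_left, this, inner_add_right,
      inner_add_right, inner_smul_left, inner_smul_right, Complex.conj_ofReal]
    ring
  have hx : Tendsto (fun n => x (φ n)) atTop (𝓝 (-z)) := by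
    have h1 : Tendsto (fun n => ContinuousLinearMap.adjoint S (y (φ n) - (l : ℂ) • x (φ n)) -
        ContinuousLinearMap.adjoint K (x (φ n))) atTop
        (𝓝 (ContinuousLinearMap.adjoint S 0 - z)) :=
      (((ContinuousLinearMap.adjoint S).continuous.tendsto 0).comp
        (h0.comp hφ.tendsto_atTop)).sub hz
    rw [map_zero, zero_sub] at h1
    exact h1.congr fun n => (key (φ n)).symm
  refine ⟨-z, mem_eigenspace_iff.2 ?_, φ, hφ, hx⟩
  have hy : Tendsto (fun n => y (φ n)) atTop (𝓝 ((l : ℂ) • -z)) := by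
    have := (h0.comp hφ.tendsto_atTop).add (hx.const_smul (l : ℂ))
    simpa [Function.comp_def] using this
  exact (hQ.isClosed : IsClosed (Q.graph : Set (H × H))).mem_of_tendsto (hx.prodMk_nhds hy)
    (Eventually.of_forall fun n => hxy (φ n))

/-- Either failure contradicts the accumulation of approximate eigenvectors. An infinite-dimensional
eigenspace contains a bounded separated sequence. A failing lower bound gives unit approximate
eigenvectors orthogonal to the eigenspace, whose limit is a unit vector both in it and orthogonal to
it. -/
theorem isFredholmAt_of_parametrix (hQ : IsSelfAdjoint Q) {l : ℝ} {S K : H →L[ℂ] H}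
    (hK : IsCompactOperator K) (hSK : ∀ v, (S v, v + K v + (l : ℂ) • S v) ∈ Q.graph) :
    IsFredholmAt Q l := by
  constructor
  · by_contra hfin
    obtain ⟨R, f, -, hfR, hf⟩ := exists_seq_norm_le_one_le_norm_sub (𝕜 := ℂ) hfin
    obtain ⟨z, -, φ, hφ, hz⟩ := exists_subseq_tendsto_eigenspace hQ hK hSK
      (x := fun n => (f n : H)) (y := fun n => (l : ℂ) • (f n : H)) hfR
      (fun n => mem_eigenspace_iff.1 (f n).2) (by simp)
    obtain ⟨N, hN⟩ := Metric.cauchySeq_iff.1 hz.cauchySeq 1 one_pos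
    have h1 := hN N le_rfl (N + 1) (Nat.le_succ N)
    rw [dist_eq_norm] at h1
    exact absurd (hf (hφ.injective.ne (Nat.lt_succ_self N).ne)) (not_le.2 h1)
  · by_contra! h
    choose x y hxy hx hlt using fun n : ℕ => h (n + 1)
    have hpos : ∀ n, 0 < ‖x n‖ := fun n =>
      lt_of_le_of_lt (mul_nonneg (by positivity) (norm_nonneg _)) (hlt n)
    obtain ⟨z, hzE, φ, hφ, hz⟩ := exists_subseq_tendsto_eigenspace hQ hK hSK
      (x := fun n => ((‖x n‖⁻¹ : ℝ) : ℂ) • x n) (y := fun n => ((‖x n‖⁻¹ : ℝ) : ℂ) • y n) (M := 1)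
      (fun n => by
        rw [norm_smul, Complex.norm_real, norm_inv, norm_norm, inv_mul_cancel₀ (hpos n).ne'])
      (fun n => Q.graph.smul_mem _ (hxy n)) (by
        refine squeeze_zero_norm (fun n => ?_) tendsto_one_div_add_atTop_nhds_zero_nat
        rw [smul_comm, ← smul_sub, norm_smul, Complex.norm_real, norm_inv, norm_norm,
          inv_mul_le_iff₀ (hpos n), mul_one_div, le_div_iff₀ (by positivity), mul_comm]
        exact (hlt n).le)
    have h1 : ‖z‖ = 1 := by
      refine tendsto_nhds_unique hz.norm ?_
      simp [norm_smul, inv_mul_cancel₀ (hpos _).ne']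
    have h2 : z ∈ (eigenspace Q (l : ℂ))ᗮ :=
      (Submodule.isClosed_orthogonal _).mem_of_tendsto hz
        (Eventually.of_forall fun n => Submodule.smul_mem _ _ (hx _))
    have h3 : z = 0 := inner_self_eq_zero.1 (h2 z hzE)
    simp [h3] at h1

/-- The essential spectrum of a self-adjoint operator consists of the points at which it is not
Fredholm. -/
theorem mem_essentialSpectrum_iff (hQ : IsSelfAdjoint Q) {l : ℂ} :
    l ∈ essentialSpectrum Q ↔ ¬ IsFredholmAt Q l := by
  rw [essentialSpectrum, Set.mem_ofPred_eq, not_iff_not]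
  have hiff : (∃ S K : H →L[ℂ] H, IsCompactOperator K ∧
      ∀ v : H, ∃ h : S v ∈ Q.domain, shift Q l ⟨S v, h⟩ = v + K v) ↔
      ∃ S K : H →L[ℂ] H, IsCompactOperator K ∧ ∀ v, (S v, v + K v + l • S v) ∈ Q.graph := by
    refine exists_congr fun S => exists_congr fun K => and_congr_right fun _ =>
      forall_congr' fun v => ⟨?_, fun h => ?_⟩
    · rintro ⟨h, hv⟩
      rw [← hv]
      exact (LinearPMap.mem_graph_iff Q).2 ⟨⟨S v, h⟩, rfl, by simp [shift]⟩
    · obtain ⟨w, hw, hw'⟩ := (LinearPMap.mem_graph_iff Q).1 h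
      dsimp only at hw hw'
      have hS : S v ∈ Q.domain := hw ▸ w.2
      refine ⟨hS, ?_⟩
      obtain rfl : w = ⟨S v, hS⟩ := Subtype.ext hw
      exact sub_eq_iff_eq_add.2 hw'
  rw [hiff]
  by_cases hl : l.im = 0
  · obtain ⟨r, rfl⟩ : ∃ r : ℝ, l = r := ⟨l.re, by apply Complex.ext <;> simp [hl]⟩
    exact ⟨fun ⟨S, K, hK, h⟩ => isFredholmAt_of_parametrix hQ hK h,
      fun h => h.exists_parametrix hQ⟩
  · have hb := isBoundedBelowAt_of_im_ne_zero hQ hl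
    refine iff_of_true ?_ hb.isFredholmAt
    obtain ⟨R, hR, -⟩ := exists_resolvent hQ hb
    exact ⟨R, 0, isCompactOperator_zero, by simpa using hR⟩

/-- `Q - m` acts on the eigenspace as the nonzero scalar `l - m`, and on the complement the bound
`c` of `Q - l` drops at most to `c - |m - l|`. The two parts are orthogonal, so a real Fredholm
point in the spectrum is isolated. -/
theorem IsFredholmAt.exists_forall_isBoundedBelowAt (hQ : IsSelfAdjoint Q) {l : ℝ}
    (h : IsFredholmAt Q l) :
    ∃ d : ℝ, 0 < d ∧ ∀ m : ℝ, m ≠ l → |m - l| < d → IsBoundedBelowAt Q m := by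
  obtain ⟨c, hc, hcE⟩ := h.exists_pos
  refine ⟨c, hc, fun m hml hm => ?_⟩
  set r := |m - l| with hr
  have hr0 : 0 < r := abs_pos.2 (sub_ne_zero.2 hml)
  have hnr : ‖(l : ℂ) - m‖ = r := by
    rw [← Complex.ofReal_sub, Complex.norm_real, Real.norm_eq_abs, abs_sub_comm]
  refine ⟨r⁻¹ + (c - r)⁻¹, fun x y hxy => ?_⟩
  obtain ⟨a, ha, b, hb, rfl⟩ := exists_eigenspace_decomposition hQ (l : ℂ) x
  have hby : (b, y - (l : ℂ) • a) ∈ Q.graph := by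
    simpa using sub_mem_graph hxy ha
  set u := y - (l : ℂ) • a - (l : ℂ) • b with hu
  set w := u + ((l : ℂ) - m) • b with hw
  have h1 : y - (m : ℂ) • (a + b) = ((l : ℂ) - m) • a + w := by
    rw [hw, hu]; module
  have h2 := norm_smul_add_sq (a := a) (w := w) (by
    rw [hw, inner_add_right, inner_eigenspace_eq_zero hQ ha hby, inner_smul_right, hb a ha]
    simp) ((l : ℂ) - m)
  have h3 : (c - r) * ‖b‖ ≤ ‖w‖ := by
    have := hcE _ _ hby hb
    have h4 : ‖u‖ ≤ ‖w‖ + r * ‖b‖ := by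
      have : u = w - ((l : ℂ) - m) • b := by rw [hw]; abel
      rw [this, ← hnr, ← norm_smul]
      exact norm_sub_le _ _
    linarith
  rw [h1]
  set t := ‖((l : ℂ) - m) • a + w‖
  rw [hnr] at h2
  have h4 : r * ‖a‖ ≤ t := le_of_sq_le_sq (by nlinarith [sq_nonneg ‖w‖]) (norm_nonneg _)
  have h5 : ‖w‖ ≤ t := le_of_sq_le_sq (by nlinarith [sq_nonneg (r * ‖a‖)]) (norm_nonneg _)
  have h6 : ‖a‖ ≤ r⁻¹ * t := (le_inv_mul_iff₀ hr0).2 h4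
  have h7 : ‖b‖ ≤ (c - r)⁻¹ * t := (le_inv_mul_iff₀ (sub_pos.2 hm)).2 (h3.trans h5)
  linarith [norm_add_le a b]

end Fredholm

/-! ### Building self-adjoint operators from graphs -/

section Construction

variable {H : Type v} [NormedAddCommGroup H] [InnerProductSpace ℂ H] [CompleteSpace H]

/-- A subspace equal to its own adjoint relation is single-valued once its first coordinates are
dense: if `(0, v)` belongs to it, then `v` is orthogonal to all first coordinates. -/
theorem exists_isSelfAdjoint_graph_eq (G : Submodule ℂ (H × H))
    (hd : Dense (Prod.fst '' (G : Set (H × H))))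
    (h : ∀ u v, (u, v) ∈ G ↔ ∀ x y, (x, y) ∈ G → ⟪y, u⟫_ℂ = ⟪x, v⟫_ℂ) :
    ∃ Q : H →ₗ.[ℂ] H, IsSelfAdjoint Q ∧ Q.graph = G := by
  have hG : G.toLinearPMap.graph = G := by
    refine G.toLinearPMap_graph_eq fun p hp hp0 => ?_
    refine hd.eq_zero_of_inner_right ℂ ?_
    rintro _ ⟨q, hq, rfl⟩
    have := (h p.1 p.2).1 hp q.1 q.2 hq
    rw [← this, hp0, inner_zero_right]
  refine ⟨G.toLinearPMap, isSelfAdjoint_of_graph ?_ (by rwa [hG]), hG⟩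
  refine hd.mono ?_
  rintro _ ⟨q, hq, rfl⟩
  exact LinearPMap.mem_domain_of_mem_graph (hG.symm ▸ hq : (q.1, q.2) ∈ G.toLinearPMap.graph)

/-- Projecting the domain gives a dense domain inside `N`. To test a pair in `N` against the graph
of `Q` it is enough to use projected pairs, since inner products with vectors of `N` do not see the
difference. -/
theorem exists_isSelfAdjoint_restrict {Q : H →ₗ.[ℂ] H} (hQ : IsSelfAdjoint Q) (N : Submodule ℂ H)
    [CompleteSpace N] (hN : ∀ x y, (x, y) ∈ Q.graph →
      (N.starProjection x, N.starProjection y) ∈ Q.graph) :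
    ∃ R : N →ₗ.[ℂ] N, IsSelfAdjoint R ∧
      ∀ x y : N, (x, y) ∈ R.graph ↔ ((x : H), (y : H)) ∈ Q.graph := by
  obtain ⟨R, hR, hRG⟩ := exists_isSelfAdjoint_graph_eq
    (Q.graph.comap (N.subtype.prodMap N.subtype)) (by
      have h1 : Dense (N.orthogonalProjectionOnto '' (Q.domain : Set H)) :=
        Function.Surjective.denseRange (f := N.orthogonalProjectionOnto)
          (fun x => ⟨x, N.orthogonalProjectionOnto_mem_subspace_eq_self x⟩) |>.dense_image
          N.orthogonalProjectionOnto.continuous hQ.dense_domain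
      refine h1.mono ?_
      rintro _ ⟨x, hx, rfl⟩
      exact ⟨(N.orthogonalProjectionOnto x, N.orthogonalProjectionOnto (Q ⟨x, hx⟩)),
        hN _ _ (Q.mem_graph ⟨x, hx⟩), rfl⟩) (by
      intro u v
      change ((u : H), (v : H)) ∈ Q.graph ↔ ∀ x y : N, ((x : H), (y : H)) ∈ Q.graph →
        ⟪(y : H), (u : H)⟫_ℂ = ⟪(x : H), (v : H)⟫_ℂ
      refine ⟨fun h x y hxy => inner_graph_comm hQ hxy h, fun h => ?_⟩
      rw [mem_graph_iff_of_isSelfAdjoint hQ]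
      intro x y hxy
      have := h (N.orthogonalProjectionOnto x) (N.orthogonalProjectionOnto y) (hN _ _ hxy)
      simpa only [← Submodule.coe_inner, Submodule.inner_orthogonalProjectionOnto_eq_of_mem_right]
        using this)
  refine ⟨R, hR, fun x y => ?_⟩
  rw [hRG]; rfl

end Construction

/-! ### Self-adjoint parts of self-adjoint operators -/

section SubOperator

variable {H₁ : Type v} [NormedAddCommGroup H₁] [InnerProductSpace ℂ H₁]
  {H₂ : Type w} [NormedAddCommGroup H₂] [InnerProductSpace ℂ H₂]
  {Q₁ : H₁ →ₗ.[ℂ] H₁} {Q₂ : H₂ →ₗ.[ℂ] H₂}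

/-- The isometry `e` maps the graph of `Q₁` into that of `Q₂`. -/
def MapsGraph (e : H₁ →ₗᵢ[ℂ] H₂) (Q₁ : H₁ →ₗ.[ℂ] H₁) (Q₂ : H₂ →ₗ.[ℂ] H₂) : Prop :=
  ∀ x y, (x, y) ∈ Q₁.graph → (e x, e y) ∈ Q₂.graph

variable {e : H₁ →ₗᵢ[ℂ] H₂}

theorem MapsGraph.map_mem_eigenspace (he : MapsGraph e Q₁ Q₂) {l : ℂ} {x : H₁}
    (hx : x ∈ eigenspace Q₁ l) : e x ∈ eigenspace Q₂ l := by
  rw [mem_eigenspace_iff] at hx ⊢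
  simpa using he _ _ hx

theorem MapsGraph.isBoundedBelowAt (he : MapsGraph e Q₁ Q₂) {l : ℂ}
    (h : IsBoundedBelowAt Q₂ l) : IsBoundedBelowAt Q₁ l := by
  obtain ⟨C, hC⟩ := h
  refine ⟨C, fun x y hxy => ?_⟩
  have := hC _ _ (he _ _ hxy)
  rwa [← map_smul, ← map_sub, e.norm_map, e.norm_map] at this

variable [CompleteSpace H₁] [CompleteSpace H₂]

/-- The adjoint of an isometry, that is, its inverse after projecting on its range. -/
noncomputable def coproj (e : H₁ →ₗᵢ[ℂ] H₂) : H₂ →L[ℂ] H₁ :=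
  ContinuousLinearMap.adjoint e.toContinuousLinearMap

theorem inner_coproj_right (e : H₁ →ₗᵢ[ℂ] H₂) (x : H₁) (y : H₂) :
    ⟪x, coproj e y⟫_ℂ = ⟪e x, y⟫_ℂ :=
  ContinuousLinearMap.adjoint_inner_right e.toContinuousLinearMap x y

theorem inner_coproj_left (e : H₁ →ₗᵢ[ℂ] H₂) (x : H₁) (y : H₂) :
    ⟪coproj e y, x⟫_ℂ = ⟪y, e x⟫_ℂ :=
  ContinuousLinearMap.adjoint_inner_left e.toContinuousLinearMap x y

@[simp]
theorem coproj_apply_self (e : H₁ →ₗᵢ[ℂ] H₂) (x : H₁) : coproj e (e x) = x :=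
  ext_inner_left ℂ fun y => by rw [inner_coproj_right, e.inner_map_map]

theorem norm_coproj_le (e : H₁ →ₗᵢ[ℂ] H₂) (y : H₂) : ‖coproj e y‖ ≤ ‖y‖ := by
  have h : ‖coproj e‖ ≤ 1 := by
    rw [coproj, LinearIsometryEquiv.norm_map]
    exact e.norm_toContinuousLinearMap_le
  simpa using (coproj e).le_of_opNorm_le h y

/-- Maximality of `Q₁` is what makes its space reducing: the symmetry of `Q₂`, tested only on the
image of the graph of `Q₁`, puts the projected pair into the graph of `Q₁† = Q₁`. -/
theorem MapsGraph.coproj_mem_graph (he : MapsGraph e Q₁ Q₂) (h₁ : IsSelfAdjoint Q₁)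
    (h₂ : IsSelfAdjoint Q₂) {x y : H₂} (hxy : (x, y) ∈ Q₂.graph) :
    (coproj e x, coproj e y) ∈ Q₁.graph := by
  rw [mem_graph_iff_of_isSelfAdjoint h₁]
  intro u v huv
  rw [inner_coproj_right, inner_coproj_right]
  exact inner_graph_comm h₂ (he _ _ huv) hxy

theorem MapsGraph.mem_graph_iff (he : MapsGraph e Q₁ Q₂) (h₁ : IsSelfAdjoint Q₁)
    (h₂ : IsSelfAdjoint Q₂) {x y : H₁} : (e x, e y) ∈ Q₂.graph ↔ (x, y) ∈ Q₁.graph :=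
  ⟨fun h => by simpa using he.coproj_mem_graph h₁ h₂ h, he x y⟩

/-- The isometry carries graph to graph, which gives `≤`; the projection carries the larger graph
back without increasing distances, which gives `≥`. -/
theorem MapsGraph.graphDist_eq (he : MapsGraph e Q₁ Q₂) (h₁ : IsSelfAdjoint Q₁)
    (h₂ : IsSelfAdjoint Q₂) (v w : H₁) : graphDist Q₂ (e v) (e w) = graphDist Q₁ v w := by
  apply le_antisymm
  · refine (Metric.le_infDist ⟨WithLp.toLp 2 (0, 0), Q₁.graph.zero_mem⟩).2 fun p hp => ?_
    refine (Metric.infDist_le_dist_of_mem (y := WithLp.toLp 2 (e p.fst, e p.snd))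
      (he _ _ hp)).trans_eq ?_
    rw [WithLp.prod_dist_eq_of_L2, WithLp.prod_dist_eq_of_L2]
    simp [e.dist_map]
  · refine (Metric.le_infDist ⟨WithLp.toLp 2 (0, 0), Q₂.graph.zero_mem⟩).2 fun p hp => ?_
    refine (Metric.infDist_le_dist_of_mem
      (y := WithLp.toLp 2 (coproj e p.fst, coproj e p.snd))
      (he.coproj_mem_graph h₁ h₂ hp)).trans ?_
    have key : ∀ (x : H₁) (y : H₂), dist x (coproj e y) ≤ dist (e x) y := by
      intro x y
      rw [dist_eq_norm, dist_eq_norm]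
      simpa using norm_coproj_le e (e x - y)
    rw [WithLp.prod_dist_eq_of_L2, WithLp.prod_dist_eq_of_L2]
    exact Real.sqrt_le_sqrt (add_le_add (pow_le_pow_left₀ dist_nonneg (key _ _) 2)
      (pow_le_pow_left₀ dist_nonneg (key _ _) 2))

theorem MapsGraph.coproj_mem_eigenspace (he : MapsGraph e Q₁ Q₂) (h₁ : IsSelfAdjoint Q₁)
    (h₂ : IsSelfAdjoint Q₂) {l : ℂ} {x : H₂} (hx : x ∈ eigenspace Q₂ l) :
    coproj e x ∈ eigenspace Q₁ l := by
  rw [mem_eigenspace_iff] at hx ⊢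
  simpa using he.coproj_mem_graph h₁ h₂ hx

theorem MapsGraph.map_mem_eigenspace_orthogonal (he : MapsGraph e Q₁ Q₂) (h₁ : IsSelfAdjoint Q₁)
    (h₂ : IsSelfAdjoint Q₂) {l : ℂ} {x : H₁} (hx : x ∈ (eigenspace Q₁ l)ᗮ) :
    e x ∈ (eigenspace Q₂ l)ᗮ := by
  intro u hu
  rw [← inner_coproj_left]
  exact hx _ (he.coproj_mem_eigenspace h₁ h₂ hu)

theorem MapsGraph.coproj_mem_eigenspace_orthogonal (he : MapsGraph e Q₁ Q₂) {l : ℂ} {x : H₂}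
    (hx : x ∈ (eigenspace Q₂ l)ᗮ) : coproj e x ∈ (eigenspace Q₁ l)ᗮ := by
  intro u hu
  rw [inner_coproj_right]
  exact hx _ (he.map_mem_eigenspace hu)

theorem MapsGraph.isFredholmAt (he : MapsGraph e Q₁ Q₂) (h₁ : IsSelfAdjoint Q₁)
    (h₂ : IsSelfAdjoint Q₂) {l : ℂ} (h : IsFredholmAt Q₂ l) : IsFredholmAt Q₁ l := by
  obtain ⟨hf, C, hC⟩ := h
  refine ⟨?_, C, fun x y hxy hx => ?_⟩
  · exact FiniteDimensional.of_injective
      ((e.toLinearMap.comp (eigenspace Q₁ l).subtype).codRestrict (eigenspace Q₂ l)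
        fun x => he.map_mem_eigenspace x.2)
      fun x y hxy => Subtype.ext (e.injective (congrArg Subtype.val hxy))
  · have := hC _ _ (he _ _ hxy) (he.map_mem_eigenspace_orthogonal h₁ h₂ hx)
    rwa [← map_smul, ← map_sub, e.norm_map, e.norm_map] at this

end SubOperator

/-! ### The sharp lower bound off an eigenspace -/

section Gap

variable {H : Type v} [NormedAddCommGroup H] [InnerProductSpace ℂ H] [CompleteSpace H]
  {Q : H →ₗ.[ℂ] H}

/-- If `Q - l I` is Fredholm and `Q - m I` is boundedly invertible for all real `m ≠ l` at distance
less than `d` from `l`, then `Q - l I` is bounded below by `d` off the eigenspace. -/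
theorem IsFredholmAt.mul_norm_le (hQ : IsSelfAdjoint Q) {l d : ℝ} (hF : IsFredholmAt Q l)
    (hd : 0 < d) (h : ∀ m : ℝ, m ≠ l → |m - l| < d → IsBoundedBelowAt Q m) {x y : H}
    (hxy : (x, y) ∈ Q.graph) (hx : x ∈ (eigenspace Q (l : ℂ))ᗮ) :
    d * ‖x‖ ≤ ‖y - (l : ℂ) • x‖ := by
  set E := eigenspace Q (l : ℂ) with hE
  -- The complement of an eigenspace reduces `Q`. Restricting to it removes `l` from the spectrum,
  -- so that no real point within `d` of `l` is left there and the resolvent estimate applies.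
  have hproj : ∀ x y, (x, y) ∈ Q.graph →
      (Eᗮ.starProjection x, Eᗮ.starProjection y) ∈ Q.graph := by
    intro x y hxy
    obtain ⟨a, ha, b, hb, rfl⟩ := exists_eigenspace_decomposition hQ (l : ℂ) x
    have hby : (b, y - (l : ℂ) • a) ∈ Q.graph := by
      simpa using sub_mem_graph hxy ha
    have h1 : Eᗮ.starProjection a = 0 :=
      (Submodule.starProjection_apply_eq_zero_iff _).2 (E.le_orthogonal_orthogonal ha)
    have h2 : y - (l : ℂ) • a ∈ Eᗮ := by
      intro e he
      have h3 := inner_eigenspace_eq_zero hQ he hby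
      rwa [inner_sub_right, inner_smul_right, hb e he, mul_zero, sub_zero] at h3
    have h4 : Eᗮ.starProjection y = y - (l : ℂ) • a := by
      rw [← Submodule.starProjection_eq_self_iff.2 h2, map_sub, map_smul, h1]; simp
    rw [h4, map_add, h1, zero_add, Submodule.starProjection_eq_self_iff.2 hb]
    exact hby
  obtain ⟨R, hR, hRG⟩ := exists_isSelfAdjoint_restrict hQ Eᗮ hproj
  have hsub : MapsGraph Eᗮ.subtypeₗᵢ R Q := fun x y hxy => (hRG x y).1 hxy
  have hy : y ∈ Eᗮ := by
    intro e he
    have h3 := inner_eigenspace_eq_zero hQ he hxy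
    rwa [inner_sub_right, inner_smul_right, hx e he, mul_zero, sub_zero] at h3
  refine mul_norm_le_of_forall_isBoundedBelowAt hR hd (l := l) (fun m hm => ?_)
    ((hRG ⟨x, hx⟩ ⟨y, hy⟩).2 hxy)
  by_cases hml : m = l
  · subst hml
    obtain ⟨-, C, hC⟩ := hF
    exact ⟨C, fun x y hxy => hC _ _ ((hRG x y).1 hxy) x.2⟩
  · exact hsub.isBoundedBelowAt (h m hml hm)

end Gap

/-! ### Spectral equivalence through Fredholm points -/

section Equivalence

variable {H₁ : Type v} [NormedAddCommGroup H₁] [InnerProductSpace ℂ H₁]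
  {H₂ : Type w} [NormedAddCommGroup H₂] [InnerProductSpace ℂ H₂]
  {H₃ : Type u} [NormedAddCommGroup H₃] [InnerProductSpace ℂ H₃]
  {Q₁ : H₁ →ₗ.[ℂ] H₁} {Q₂ : H₂ →ₗ.[ℂ] H₂} {Q₃ : H₃ →ₗ.[ℂ] H₃}

theorem SpectrallyEquivalent.symm (h : SpectrallyEquivalent Q₁ Q₂) :
    SpectrallyEquivalent Q₂ Q₁ := by
  obtain ⟨h1, h2, h3⟩ := h
  refine ⟨h1.symm, h2.symm, fun l hl => (h3 l ?_).symm⟩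
  rwa [h1, h2]

theorem SpectrallyEquivalent.trans (h : SpectrallyEquivalent Q₁ Q₂)
    (h' : SpectrallyEquivalent Q₂ Q₃) : SpectrallyEquivalent Q₁ Q₃ := by
  obtain ⟨h1, h2, h3⟩ := h
  obtain ⟨h1', h2', h3'⟩ := h'
  refine ⟨h1.trans h1', h2.trans h2', fun l hl => ?_⟩
  have e1 := congrArg Cardinal.lift.{u} (h3 l hl)
  have e2 := congrArg Cardinal.lift.{v} (h3' l (by rwa [← h1, ← h2]))
  rw [Cardinal.lift_lift, Cardinal.lift_lift] at e1 e2
  apply Cardinal.lift_injective.{w}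
  rw [Cardinal.lift_lift, Cardinal.lift_lift]
  exact e1.trans e2

variable [CompleteSpace H₁] [CompleteSpace H₂]

/-- Equality of spectra becomes redundant: a point outside the spectrum is a Fredholm point with
eigenspace of dimension zero. -/
theorem spectrallyEquivalent_iff (h₁ : IsSelfAdjoint Q₁) (h₂ : IsSelfAdjoint Q₂) :
    SpectrallyEquivalent Q₁ Q₂ ↔ ∀ l, (IsFredholmAt Q₁ l ↔ IsFredholmAt Q₂ l) ∧
      (IsFredholmAt Q₁ l → Cardinal.lift.{w} (Module.rank ℂ (eigenspace Q₁ l)) =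
        Cardinal.lift.{v} (Module.rank ℂ (eigenspace Q₂ l))) := by
  rw [SpectrallyEquivalent, Set.ext_iff, Set.ext_iff]
  simp only [Set.mem_sdiff, mem_operatorSpectrum_iff h₁, mem_operatorSpectrum_iff h₂,
    mem_essentialSpectrum_iff h₁, mem_essentialSpectrum_iff h₂, not_not, not_iff_not]
  constructor
  · rintro ⟨hb, hF, hr⟩ l
    refine ⟨hF l, fun hl => ?_⟩
    by_cases hbl : IsBoundedBelowAt Q₁ l
    · rw [hbl.eigenspace_eq_bot, ((hb l).1 hbl).eigenspace_eq_bot]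
      simp
    · exact hr l ⟨hbl, hl⟩
  · intro h
    refine ⟨fun l => ?_, fun l => (h l).1, fun l hl => (h l).2 hl.2⟩
    rw [isBoundedBelowAt_iff, isBoundedBelowAt_iff, ← (h l).1]
    refine and_congr_right fun hl => ?_
    have hr := (h l).2 hl
    rw [← Submodule.rank_eq_zero, ← Submodule.rank_eq_zero]
    constructor
    · intro h0
      rwa [h0, Cardinal.lift_zero, eq_comm, Cardinal.lift_eq_zero] at hr
    · intro h0
      rwa [h0, Cardinal.lift_zero, Cardinal.lift_eq_zero] at hr

/-- A reducing part with the same non-Fredholm points that contains the eigenspaces of the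
Fredholm points is spectrally equivalent to the whole operator. -/
theorem MapsGraph.spectrallyEquivalent {e : H₁ →ₗᵢ[ℂ] H₂} (he : MapsGraph e Q₁ Q₂)
    (h₁ : IsSelfAdjoint Q₁) (h₂ : IsSelfAdjoint Q₂)
    (hF : ∀ l, IsFredholmAt Q₁ l → IsFredholmAt Q₂ l)
    (hr : ∀ l, IsFredholmAt Q₂ l → ∀ x ∈ eigenspace Q₂ l, ∃ y, e y = x) :
    SpectrallyEquivalent Q₁ Q₂ := by
  rw [spectrallyEquivalent_iff h₁ h₂]
  refine fun l => ⟨⟨hF l, he.isFredholmAt h₁ h₂⟩, fun hl => ?_⟩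
  let f := (e.toLinearMap.comp (eigenspace Q₁ l).subtype).codRestrict (eigenspace Q₂ l)
    fun x => he.map_mem_eigenspace x.2
  refine (LinearEquiv.ofBijective f ⟨?_, ?_⟩).lift_rank_eq
  · exact fun x y hxy => Subtype.ext (e.injective (congrArg Subtype.val hxy))
  · rintro ⟨x, hx⟩
    obtain ⟨y, rfl⟩ := hr l (hF l hl) x hx
    have := he.coproj_mem_eigenspace h₁ h₂ hx
    rw [coproj_apply_self] at this
    exact ⟨⟨y, this⟩, rfl⟩

theorem spectrallyEquivalent_of_linearIsometryEquiv (e : H₁ ≃ₗᵢ[ℂ] H₂)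
    (he : MapsGraph e.toLinearIsometry Q₁ Q₂) (h₁ : IsSelfAdjoint Q₁) (h₂ : IsSelfAdjoint Q₂) :
    SpectrallyEquivalent Q₁ Q₂ := by
  refine he.spectrallyEquivalent h₁ h₂ (fun l hl => ?_) fun l _ x _ => ⟨e.symm x, by simp⟩
  refine MapsGraph.isFredholmAt (e := e.symm.toLinearIsometry) (fun x y hxy => ?_) h₂ h₁ hl
  rw [← he.mem_graph_iff h₁ h₂]
  simpa using hxy

end Equivalence

/-! ### Limits of directed families of operators -/

section Chain

variable {ι : Type a} [Preorder ι]
  {H : ι → Type v} [∀ i, NormedAddCommGroup (H i)] [∀ i, InnerProductSpace ℂ (H i)]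
  [∀ i, CompleteSpace (H i)]
  {K : Type w} [NormedAddCommGroup K] [InnerProductSpace ℂ K] [CompleteSpace K]
  {j : ∀ i, H i →ₗᵢ[ℂ] K}

/-- Projections onto increasing subspaces with dense union converge strongly to the identity: they
eventually fix a vector close to `x`, and they are contractions. -/
theorem tendsto_coproj (hmono : ∀ i k, i ≤ k → Set.range (j i) ⊆ Set.range (j k))
    (hdense : Dense (⋃ i, Set.range (j i))) (x : K) :
    Tendsto (fun i => j i (coproj (j i) x)) atTop (𝓝 x) := by
  rw [Metric.tendsto_nhds]
  intro ε hε
  obtain ⟨y, hy, hxy⟩ := Metric.dense_iff.1 hdense x (ε / 2) (half_pos hε)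
  obtain ⟨i, hi⟩ := Set.mem_iUnion.1 hxy
  filter_upwards [eventually_ge_atTop i] with k hk
  obtain ⟨z, rfl⟩ := hmono i k hk hi
  rw [Metric.mem_ball] at hy
  calc dist (j k (coproj (j k) x)) x ≤ dist (j k (coproj (j k) x)) (j k z) + dist (j k z) x :=
        dist_triangle _ _ _
    _ < ε / 2 + ε / 2 := by
        refine add_lt_add (lt_of_le_of_lt ?_ hy) hy
        have h1 : coproj (j k) x - z = coproj (j k) (x - j k z) := by simp
        rw [(j k).dist_map, dist_eq_norm, h1, dist_eq_norm, norm_sub_rev]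
        rw [norm_sub_rev]
        exact (norm_coproj_le _ _).trans_eq (norm_sub_rev _ _)
    _ = ε := add_halves ε

variable [IsDirectedOrder ι] [Nonempty ι] {Q : ∀ i, H i →ₗ.[ℂ] H i}

/-- The limit of a directed family of self-adjoint operators, each reducing the later ones. -/
theorem exists_isSelfAdjoint_limit (hQ : ∀ i, IsSelfAdjoint (Q i))
    (hmono : ∀ i k, i ≤ k → ∃ f : H i →ₗᵢ[ℂ] H k, MapsGraph f (Q i) (Q k) ∧ ∀ x, j k (f x) = j i x)
    (hdense : Dense (⋃ i, Set.range (j i))) :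
    ∃ R : K →ₗ.[ℂ] K, IsSelfAdjoint R ∧ ∀ i, MapsGraph (j i) (Q i) R := by
  have hrange : ∀ i k, i ≤ k → Set.range (j i) ⊆ Set.range (j k) := by
    rintro i k hik _ ⟨x, rfl⟩
    obtain ⟨f, -, hf⟩ := hmono i k hik
    exact ⟨f x, hf x⟩
  have hlim := tendsto_coproj hrange hdense
  -- Taking all pairs whose projections lie in every graph, instead of the closure of the union of
  -- the graphs, makes `G` maximal by definition; its symmetry then follows by passing to the limit
  -- along the projections.
  let G : Submodule ℂ (K × K) := ⨅ i, (Q i).graph.comap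
    ((coproj (j i) : K →ₗ[ℂ] H i).prodMap (coproj (j i) : K →ₗ[ℂ] H i))
  have hG : ∀ {x y}, (x, y) ∈ G ↔ ∀ i, (coproj (j i) x, coproj (j i) y) ∈ (Q i).graph := by
    intro x y; simp [G]
  have hcoproj : ∀ {i k} (f : H i →ₗᵢ[ℂ] H k), (∀ x, j k (f x) = j i x) →
      ∀ x, coproj (j i) x = coproj f (coproj (j k) x) := by
    intro i k f hf x
    refine ext_inner_left ℂ fun y => ?_
    rw [inner_coproj_right, inner_coproj_right, inner_coproj_right, hf]
  have hmaps : ∀ i x y, (x, y) ∈ (Q i).graph → (j i x, j i y) ∈ G := by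
    intro i x y hxy
    rw [hG]
    intro k
    -- Push the pair from stage `i` up to a common bound `m`, then project down to stage `k`.
    obtain ⟨m, him, hkm⟩ := exists_ge_ge i k
    obtain ⟨f, hf, hfj⟩ := hmono i m him
    obtain ⟨g, hg, hgj⟩ := hmono k m hkm
    rw [hcoproj g hgj, hcoproj g hgj, ← hfj, ← hfj, coproj_apply_self, coproj_apply_self]
    exact hg.coproj_mem_graph (hQ k) (hQ m) (hf _ _ hxy)
  obtain ⟨R, hR, hRG⟩ := exists_isSelfAdjoint_graph_eq G (by
    have h1 : Dense (⋃ i, j i '' ((Q i).domain : Set (H i))) := by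
      refine dense_closure.1 (hdense.mono (Set.iUnion_subset fun i => ?_))
      rintro _ ⟨x, rfl⟩
      exact closure_mono (Set.subset_iUnion _ i) (image_closure_subset_closure_image
        (j i).continuous ⟨x, (hQ i).dense_domain x, rfl⟩)
    refine h1.mono (Set.iUnion_subset fun i => ?_)
    rintro _ ⟨x, hx, rfl⟩
    exact ⟨_, hmaps i _ _ ((Q i).mem_graph ⟨x, hx⟩), rfl⟩) (by
    intro u v
    refine ⟨fun h x y hxy => ?_, fun h => ?_⟩
    · refine tendsto_nhds_unique ((hlim y).inner (hlim u)) (((hlim x).inner (hlim v)).congr ?_)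
      intro i
      rw [(j i).inner_map_map, (j i).inner_map_map]
      exact (inner_graph_comm (hQ i) (hG.1 hxy i) (hG.1 h i)).symm
    · rw [hG]
      intro i
      rw [mem_graph_iff_of_isSelfAdjoint (hQ i)]
      intro x y hxy
      rw [inner_coproj_right, inner_coproj_right]
      exact h _ _ (hmaps i x y hxy))
  exact ⟨R, hR, fun i x y hxy => hRG ▸ hmaps i x y hxy⟩

/-- At a Fredholm point the eigenspaces stabilise by dimension, and the lower bound must not decay
along the family. It does not, because the isolation radius `d` depends only on the common spectrum.
-/
theorem spectrallyEquivalent_limit (hQ : ∀ i, IsSelfAdjoint (Q i)) {R : K →ₗ.[ℂ] K}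
    (hR : IsSelfAdjoint R) (hj : ∀ i, MapsGraph (j i) (Q i) R)
    (hmono : ∀ i k, i ≤ k → Set.range (j i) ⊆ Set.range (j k))
    (hdense : Dense (⋃ i, Set.range (j i))) (o : ι)
    (ho : ∀ i, SpectrallyEquivalent (Q i) (Q o)) : SpectrallyEquivalent (Q o) R := by
  have key : ∀ l, IsFredholmAt (Q o) l → IsFredholmAt R l ∧
      ∀ x ∈ eigenspace R l, ∃ y, j o y = x := by
    intro l hl
    by_cases him : l.im = 0
    swap
    · have hb := isBoundedBelowAt_of_im_ne_zero hR him
      refine ⟨hb.isFredholmAt, fun x hx => ⟨0, ?_⟩⟩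
      rw [hb.eigenspace_eq_bot, Submodule.mem_bot] at hx
      rw [hx, map_zero]
    obtain ⟨r, rfl⟩ : ∃ r : ℝ, l = r := ⟨l.re, by apply Complex.ext <;> simp [him]⟩
    have ho' := fun i => (spectrallyEquivalent_iff (hQ i) (hQ o)).1 (ho i)
    have hF : ∀ i, IsFredholmAt (Q i) r := fun i => (ho' i r).1.2 hl
    have hrank : ∀ i, Module.finrank ℂ (eigenspace (Q i) (r : ℂ)) =
        Module.finrank ℂ (eigenspace (Q o) (r : ℂ)) := by
      intro i
      rw [Module.finrank, Module.finrank, ← Cardinal.lift_injective ((ho' i r).2 (hF i))]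
    let E := fun i => (eigenspace (Q i) (r : ℂ)).map (j i).toLinearMap
    have hfin : ∀ i, FiniteDimensional ℂ (E i) := fun i => by
      have := (hF i).1
      infer_instance
    have hEdim : ∀ i, Module.finrank ℂ (E i) = Module.finrank ℂ (E o) := by
      intro i
      rw [← (Submodule.equivMapOfInjective _ (j i).injective _).finrank_eq,
        ← (Submodule.equivMapOfInjective _ (j o).injective _).finrank_eq, hrank]
    -- The eigenspaces grow with `k` and have the same finite dimension. Being finite-dimensional,
    -- `E o` is also closed, so the limit has no further eigenvectors.
    have hE : ∀ k, o ≤ k → E k = E o := by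
      intro k hk
      symm
      have := hfin k
      refine Submodule.eq_of_le_of_finrank_eq ?_ (hEdim k).symm
      rintro _ ⟨x, hx, rfl⟩
      obtain ⟨y, hy⟩ := hmono o k hk ⟨x, rfl⟩
      refine ⟨y, ?_, hy⟩
      have := (hj k).coproj_mem_eigenspace (hQ k) hR ((hj o).map_mem_eigenspace hx)
      rwa [← hy, coproj_apply_self] at this
    have hlim := tendsto_coproj hmono hdense
    have hRE : eigenspace R (r : ℂ) ≤ E o := by
      intro x hx
      have := hfin o
      refine (E o).closed_of_finiteDimensional.mem_of_tendsto (hlim x) ?_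
      filter_upwards [eventually_ge_atTop o] with k hk
      rw [← hE k hk]
      exact ⟨_, (hj k).coproj_mem_eigenspace (hQ k) hR hx, rfl⟩
    refine ⟨⟨?_, ?_⟩, fun x hx => ?_⟩
    · have := hfin o
      exact Submodule.finiteDimensional_of_le hRE
    · obtain ⟨d, hd, hdo⟩ := hl.exists_forall_isBoundedBelowAt (hQ o)
      refine ⟨d⁻¹, fun x y hxy hx => (le_inv_mul_iff₀ hd).2 ?_⟩
      refine le_of_tendsto ((hlim x).norm.const_mul d) (Eventually.of_forall fun i => ?_)
      -- The radius found for `Q o` serves every `Q i`, as all the spectra coincide.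
      have hb : ∀ m : ℝ, m ≠ r → |m - r| < d → IsBoundedBelowAt (Q i) m := by
        intro m hmr hm
        by_contra hn
        rw [← mem_operatorSpectrum_iff (hQ i), (ho i).1, mem_operatorSpectrum_iff (hQ o)] at hn
        exact hn (hdo m hmr hm)
      have := (hF i).mul_norm_le (hQ i) hd hb ((hj i).coproj_mem_graph (hQ i) hR hxy)
        ((hj i).coproj_mem_eigenspace_orthogonal hx)
      rw [← map_smul, ← map_sub] at this
      rw [(j i).norm_map]
      exact this.trans (norm_coproj_le _ _)
    · obtain ⟨y, -, hy⟩ := hRE hx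
      exact ⟨y, hy⟩
  exact (hj o).spectrallyEquivalent (hQ o) hR (fun l hl => (key l hl).1)
    fun l hl => (key l ((hj o).isFredholmAt (hQ o) hR hl)).2

end Chain

/-! ### Small reducing subspaces with the same spectral data -/

section LowenheimSkolem

variable {H : Type v} [NormedAddCommGroup H] [InnerProductSpace ℂ H]

theorem mk_span_le {κ : Cardinal.{v}} (hκ : 𝔠 ≤ κ) {B : Set H} (hB : #B ≤ κ) :
    #(Submodule.span ℂ B) ≤ κ := by
  have h1 : #(B →₀ ℂ) ≤ κ := by
    rcases isEmpty_or_nonempty B with h | h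
    · rw [Cardinal.mk_eq_one]
      exact Cardinal.one_le_aleph0.trans (Cardinal.aleph0_le_continuum.trans hκ)
    · rw [Cardinal.mk_finsupp_lift_of_infinite']
      simpa using ⟨hB, hκ⟩
  have h2 : (Submodule.span ℂ B : Set H) =
      Set.range (Finsupp.linearCombination ℂ ((↑) : B → H)) := by
    rw [← LinearMap.coe_range, Finsupp.range_linearCombination, Subtype.range_coe]
  change #(Submodule.span ℂ B : Set H) ≤ κ
  rw [h2]
  exact Cardinal.mk_range_le.trans h1

/-- Witnesses for the position of `l` with respect to the essential spectrum. -/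
theorem exists_fredholm_witnesses (Q : H →ₗ.[ℂ] H) (l : ℂ) :
    ∃ W : Set H, #W ≤ 𝔠 ∧ (IsFredholmAt Q l → (eigenspace Q l : Set H) ⊆ W) ∧
      (¬ IsFredholmAt Q l →
        (∃ f : ℕ → H, LinearIndependent ℂ f ∧ ∀ n, f n ∈ eigenspace Q l ∧ f n ∈ W) ∨
        ∃ x y : ℕ → H, ∀ n : ℕ, (x n, y n) ∈ Q.graph ∧ x n ∈ (eigenspace Q l)ᗮ ∧ x n ∈ W ∧
          y n ∈ W ∧ n * ‖y n - l • x n‖ < ‖x n‖) := by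
  by_cases hF : IsFredholmAt Q l
  · refine ⟨eigenspace Q l, ?_, fun _ => subset_rfl, fun h => absurd hF h⟩
    obtain ⟨s, hs⟩ := (Submodule.fg_iff_finiteDimensional _).2 hF.1
    rw [← hs]
    exact mk_span_le le_rfl ((Cardinal.lt_aleph0_of_finite (s : Set H)).le.trans
      Cardinal.aleph0_le_continuum)
  · by_cases hfin : FiniteDimensional ℂ (eigenspace Q l)
    · have h : ∀ n : ℕ, ∃ x y, (x, y) ∈ Q.graph ∧ x ∈ (eigenspace Q l)ᗮ ∧
          n * ‖y - l • x‖ < ‖x‖ := by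
        by_contra! h
        obtain ⟨n, hn⟩ := h
        exact hF ⟨hfin, n, hn⟩
      choose x y hxy hx hn using h
      refine ⟨Set.range x ∪ Set.range y, ?_, fun h => absurd h hF, fun _ => Or.inr ⟨x, y,
        fun n => ⟨hxy n, hx n, Or.inl ⟨n, rfl⟩, Or.inr ⟨n, rfl⟩, hn n⟩⟩⟩
      exact (((Set.countable_range x).union (Set.countable_range y)).le_aleph0).trans
        Cardinal.aleph0_le_continuum
    · let bas := Module.Basis.ofVectorSpace ℂ (eigenspace Q l)
      have hinf : Infinite (Module.Basis.ofVectorSpaceIndex ℂ (eigenspace Q l)) := by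
        by_contra h
        rw [not_infinite_iff_finite] at h
        exact hfin (Module.Finite.of_basis bas)
      let f : ℕ → H := fun n => (bas (Infinite.natEmbedding _ n) : H)
      refine ⟨Set.range f, (Set.countable_range f).le_aleph0.trans Cardinal.aleph0_le_continuum,
        fun h => absurd h hF, fun _ => Or.inl ⟨f, ?_, fun n => ⟨Subtype.mem _, n, rfl⟩⟩⟩
      exact (bas.linearIndependent.comp _ (Infinite.natEmbedding _).injective).map'
        (eigenspace Q l).subtype (Submodule.ker_subtype _)

variable [CompleteSpace H] {Q : H →ₗ.[ℂ] H}

/-- Every set is contained in a reducing closed subspace of small density character. -/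
theorem exists_reducing_submodule (hQ : IsSelfAdjoint Q) {κ : Cardinal.{v}} (hκ : 𝔠 ≤ κ)
    {B : Set H} (hB : #B ≤ κ) :
    ∃ M N : Submodule ℂ H, N = M.topologicalClosure ∧ B ⊆ N ∧ #M ≤ κ ∧
      ∀ [N.HasOrthogonalProjection], ∀ x y, (x, y) ∈ Q.graph →
        (N.starProjection x, N.starProjection y) ∈ Q.graph := by
  obtain ⟨R, hR, hR'⟩ := exists_resolvent hQ
    (isBoundedBelowAt_of_im_ne_zero hQ (l := Complex.I) (by simp))
  obtain ⟨S, hS, -⟩ := exists_resolvent hQ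
    (isBoundedBelowAt_of_im_ne_zero hQ (l := -Complex.I) (by simp))
  have hRS : ∀ u v, ⟪u, R v⟫_ℂ = ⟪S u, v⟫_ℂ := by
    intro u v
    have := inner_graph_comm hQ (hS u) (hR v)
    rw [inner_add_left, inner_add_right, inner_smul_left, inner_smul_right] at this
    simpa using this
  -- All words in `R = (Q - i)⁻¹` and `S = (Q + i)⁻¹ = R†` applied to `B`. Their closed span is
  -- invariant under `R` and its adjoint, so its projection commutes with `R` and hence preserves
  -- the graph of `Q`.
  let g : List Bool × B → H := fun p => p.1.foldr (fun c v => if c then R v else S v) p.2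
  have hg : #(Set.range g) ≤ κ := by
    have h0 : ℵ₀ ≤ κ := Cardinal.aleph0_le_continuum.trans hκ
    refine Cardinal.mk_range_le.trans ?_
    rw [Cardinal.mk_prod]
    refine (mul_le_mul' ?_ ?_).trans (Cardinal.mul_eq_self h0).le
    · rw [Cardinal.mk_list_eq_aleph0]; simpa using h0
    · simpa using hB
  let M := Submodule.span ℂ (Set.range g)
  have hinv : ∀ T : H →L[ℂ] H, (∀ p, T (g p) ∈ Set.range g) →
      ∀ x ∈ M.topologicalClosure, T x ∈ M.topologicalClosure := by
    intro T hT x hx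
    have h1 : ∀ x ∈ M, T x ∈ M := by
      change M ≤ M.comap (T : H →ₗ[ℂ] H)
      refine Submodule.span_le.2 ?_
      rintro _ ⟨p, rfl⟩
      exact Submodule.subset_span (hT p)
    exact map_mem_closure T.continuous hx h1
  have hRi := hinv R fun p => ⟨(true :: p.1, p.2), rfl⟩
  have hSi := hinv S fun p => ⟨(false :: p.1, p.2), rfl⟩
  refine ⟨M, M.topologicalClosure, rfl, fun x hx => ?_, mk_span_le hκ hg, ?_⟩
  · exact M.le_topologicalClosure (Submodule.subset_span ⟨([], ⟨x, hx⟩), rfl⟩)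
  · intro _ x y hxy
    set N := M.topologicalClosure
    have h1 : N.starProjection x = R (N.starProjection (y - Complex.I • x)) := by
      conv_lhs => rw [← hR' x y hxy]
      refine Submodule.eq_starProjection_of_mem_of_inner_eq_zero
        (hRi _ (N.starProjection_apply_mem _)) fun w hw => ?_
      rw [← map_sub, ← inner_conj_symm, hRS, inner_conj_symm]
      exact Submodule.starProjection_inner_eq_zero _ _ (hSi w hw)
    have h2 := hR (N.starProjection (y - Complex.I • x))
    rw [← h1, map_sub, map_smul, sub_add_cancel] at h2
    exact h2

/-- Downward Löwenheim-Skolem: every set of vectors is contained in a reducing closed subspace of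
small density character on which the operator has the same spectral data. -/
theorem exists_spectrallyEquivalent_restrict (hQ : IsSelfAdjoint Q) (A : Set H) :
    ∃ (N : Submodule ℂ H) (R : N →ₗ.[ℂ] N) (_ : CompleteSpace N), IsSelfAdjoint R ∧
      MapsGraph N.subtypeₗᵢ R Q ∧ SpectrallyEquivalent R Q ∧ A ⊆ N ∧
      ∃ s : Set N, Dense s ∧ #s ≤ #A + 𝔠 := by
  choose W hW hWF hWn using exists_fredholm_witnesses Q
  have hκ : 𝔠 ≤ #A + 𝔠 := self_le_add_left _ _
  have hB : #(A ∪ ⋃ l, W l : Set H) ≤ #A + 𝔠 := by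
    refine (Cardinal.mk_union_le _ _).trans (add_le_add le_rfl ?_)
    have h1 := Cardinal.mk_iUnion_le_lift W
    rw [Cardinal.lift_id', Cardinal.mk_complex, Cardinal.lift_continuum] at h1
    refine h1.trans ?_
    refine (mul_le_mul_right (ciSup_le' fun l => ?_) _).trans Cardinal.continuum_mul_self.le
    simpa using hW l
  obtain ⟨M, N, hMN, hBN, hM, hred⟩ := exists_reducing_submodule hQ hκ hB
  have hcl : IsClosed (N : Set H) := by rw [hMN]; exact M.isClosed_topologicalClosure
  have hc : CompleteSpace N := hcl.completeSpace_coe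
  obtain ⟨R, hR, hRG⟩ := exists_isSelfAdjoint_restrict hQ N hred
  have he : MapsGraph N.subtypeₗᵢ R Q := fun x y hxy => (hRG x y).1 hxy
  have hWN : ∀ l, W l ⊆ N := fun l =>
    (Set.subset_iUnion W l).trans (Set.subset_union_right.trans hBN)
  refine ⟨N, R, hc, hR, he, he.spectrallyEquivalent hR hQ (fun l hl => ?_)
    fun l hl x hx => ⟨⟨x, hWN l (hWF l hl hx)⟩, rfl⟩, Set.subset_union_left.trans hBN,
    ((↑) : N → H) ⁻¹' M, ?_, ?_⟩
  · by_contra hn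
    -- Witnesses of non-Fredholmness for `Q` lie in `N` and witness the same for the restriction:
    -- either infinitely many independent eigenvectors, or vectors violating every lower bound.
    rcases hWn l hn with ⟨f, hf, hfW⟩ | ⟨x, y, hxy⟩
    · have hfin := hl.1
      let g : ℕ → eigenspace R l := fun n => ⟨⟨f n, hWN l (hfW n).2⟩,
        mem_eigenspace_iff.2 ((hRG _ _).2 (mem_eigenspace_iff.1 (hfW n).1))⟩
      refine Module.Finite.not_linearIndependent_of_infinite (R := ℂ) g ?_
      exact LinearIndependent.of_comp (N.subtype.comp (eigenspace R l).subtype) hf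
    · obtain ⟨-, C, hC⟩ := hl
      obtain ⟨n, hn⟩ := exists_nat_ge C
      obtain ⟨h1, h2, h3, h4, h5⟩ := hxy n
      have h6 := hC ⟨x n, hWN l h3⟩ ⟨y n, hWN l h4⟩ ((hRG _ _).2 h1)
        fun u hu => h2 _ (he.map_mem_eigenspace hu)
      have h7 : ‖x n‖ ≤ C * ‖y n - l • x n‖ := h6
      exact absurd h5 (not_lt.2 (h7.trans (mul_le_mul_of_nonneg_right hn (norm_nonneg _))))
  · intro x
    have hx : (x : H) ∈ closure (M : Set H) := by
      subst hMN; exact x.2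
    have hsub : (M : Set H) ⊆ N := by rw [hMN]; exact M.le_topologicalClosure
    rwa [closure_subtype, Set.image_preimage_eq_of_subset (by rwa [Subtype.range_coe])]
  · exact (Cardinal.mk_preimage_of_injective _ _ Subtype.val_injective).trans hM

end LowenheimSkolem

/-! ### Substructures and completions of unions -/

namespace MetricStructure

variable {L : FirstOrder.Language.{a, b}} {M N P : MetricStructure.{u} L}

theorem IsSubstructure.refl (M : MetricStructure.{u} L) : M.IsSubstructure M :=
  ⟨fun _ h => h, fun _ _ => rfl, fun _ _ => rfl, fun _ _ => rfl⟩

theorem IsSubstructure.trans (h : M.IsSubstructure N) (h' : N.IsSubstructure P) :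
    M.IsSubstructure P := by
  obtain ⟨h1, hd, hf, hp⟩ := h
  obtain ⟨h1', hd', hf', hp'⟩ := h'
  exact ⟨fun x hx => h1' (h1 hx), fun x y => (hd x y).trans (hd' _ _),
    fun F x => (hf F x).trans (hf' F _), fun R x => (hp R x).trans (hp' R _)⟩

theorem IsSubstructure.antisymm (h : M.IsSubstructure N) (h' : N.IsSubstructure M) : M = N := by
  obtain ⟨c, m, hc, f, p, hf, hp⟩ := M
  obtain ⟨c', m', hc', f', p', hf', hp'⟩ := N
  obtain ⟨h1, hd, hF, hP⟩ := h
  obtain ⟨h1', -⟩ := h'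
  obtain rfl : c = c' := le_antisymm h1 h1'
  obtain rfl : m = m' := MetricSpace.ext (by ext x y; exact hd x y)
  obtain rfl : @f = @f' := by
    funext n F x; exact Subtype.ext (hF F x)
  obtain rfl : @p = @p' := by
    funext n R x; exact hP R x
  rfl

/-- Isomorphisms that extend one another carry substructures to substructures. -/
theorem IsSubstructure.of_iso {N₁ N₂ M₁ M₂ : MetricStructure.{u} L} (f₁ : N₁.Iso M₁)
    (f₂ : N₂.Iso M₂) (hf : f₁.Extends f₂) (h : N₁.IsSubstructure N₂) : M₁.IsSubstructure M₂ := by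
  obtain ⟨h1, hd, hF, hP⟩ := h
  have key : ∀ x : N₁.carrier, (f₂.toEquiv ⟨x, h1 x.2⟩ : ZFSet.{u}) = f₁.toEquiv x := fun x =>
    (hf x).2
  have hsub : M₁.carrier ⊆ M₂.carrier := by
    intro z hz
    obtain ⟨x, hx⟩ := f₁.toEquiv.surjective ⟨z, hz⟩
    have := (f₂.toEquiv ⟨x, h1 x.2⟩).2
    rwa [key, hx] at this
  have key' : ∀ x : N₁.carrier,
      (⟨f₁.toEquiv x, hsub (f₁.toEquiv x).2⟩ : M₂.carrier) = f₂.toEquiv ⟨x, h1 x.2⟩ :=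
    fun x => Subtype.ext (key x).symm
  refine ⟨hsub, fun x y => ?_, fun {n} F x => ?_, fun {n} R x => ?_⟩
  · obtain ⟨x, rfl⟩ := f₁.toEquiv.surjective x
    obtain ⟨y, rfl⟩ := f₁.toEquiv.surjective y
    rw [key', key', f₁.map_dist, f₂.map_dist, hd]
  · obtain ⟨x, rfl⟩ : ∃ y : Fin n → N₁.carrier, x = fun i => f₁.toEquiv (y i) :=
      ⟨fun i => f₁.toEquiv.symm (x i), by simp⟩
    simp only [key']
    rw [← f₁.map_func, ← f₂.map_func, ← key]
    congr 2
    exact Subtype.ext (hF F x)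
  · obtain ⟨x, rfl⟩ : ∃ y : Fin n → N₁.carrier, x = fun i => f₁.toEquiv (y i) :=
      ⟨fun i => f₁.toEquiv.symm (x i), by simp⟩
    simp only [key']
    rw [f₁.map_pred, f₂.map_pred, hP]

/-- A closed subset that is closed under the function symbols carries a substructure. -/
theorem exists_isSubstructure_of_isClosed (N : MetricStructure.{u} L) (C : Set N.carrier)
    (hC : IsClosed C) (hf : ∀ {n : ℕ} (F : L.Functions n) (x : Fin n → N.carrier),
      (∀ i, x i ∈ C) → N.func F x ∈ C) :
    ∃ U : MetricStructure.{u} L, U.IsSubstructure N ∧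
      ∀ x : N.carrier, (x : ZFSet.{u}) ∈ U.carrier ↔ x ∈ C := by
  let c : ZFSet.{u} := ZFSet.sep (fun z => ∃ h : z ∈ N.carrier, (⟨z, h⟩ : N.carrier) ∈ C) N.carrier
  have hc : ∀ {z}, z ∈ c ↔ ∃ h : z ∈ N.carrier, (⟨z, h⟩ : N.carrier) ∈ C := by
    intro z
    rw [ZFSet.mem_sep]
    exact ⟨fun h => h.2, fun h => ⟨h.1, h⟩⟩
  let inc : c → N.carrier := fun x => ⟨x, (hc.1 x.2).1⟩
  have hinc : ∀ x, inc x ∈ C := fun x => (hc.1 x.2).2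
  have hinj : Function.Injective inc := fun x y h =>
    Subtype.ext (show (inc x : ZFSet.{u}) = inc y from congrArg Subtype.val h)
  let m : MetricSpace c := MetricSpace.induced inc hinj N.metric
  have hiso : Isometry inc := Isometry.of_dist_eq fun _ _ => rfl
  have hrange : Set.range inc = C := by
    ext x
    exact ⟨fun ⟨y, hy⟩ => hy ▸ hinc y, fun hx => ⟨⟨x, hc.2 ⟨x.2, hx⟩⟩, rfl⟩⟩
  have hcompl : CompleteSpace c := by
    rw [completeSpace_iff_isComplete_range hiso.isUniformInducing, hrange]
    exact hC.isComplete
  refine ⟨{ carrier := c, metric := m, complete := hcompl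
            func := fun F x => ⟨N.func F fun i => inc (x i), hc.2
              ⟨Subtype.mem _, hf F _ fun i => hinc _⟩⟩
            pred := fun R x => N.pred R fun i => inc (x i)
            continuous_func := fun F => ?_
            continuous_pred := fun R => ?_ }, ?_, ?_⟩
  · rw [hiso.isEmbedding.continuous_iff]
    exact (N.continuous_func F).comp
      (continuous_pi fun i => hiso.continuous.comp (continuous_apply i))
  · exact (N.continuous_pred R).comp
      (continuous_pi fun i => hiso.continuous.comp (continuous_apply i))
  · exact ⟨fun x hx => (hc.1 hx).1, fun _ _ => rfl, fun _ _ => rfl, fun _ _ => rfl⟩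
  · exact fun x => hc.trans ⟨fun h => h.2, fun h => ⟨x.2, h⟩⟩

section Union

variable {ι : Type u} [LinearOrder ι] [Nonempty ι] {A : ι → MetricStructure.{u} L}

theorem exists_forall_mem_carrier (hA : ∀ i j, i ≤ j → (A i).IsSubstructure (A j)) {n : ℕ}
    (x : Fin n → ZFSet.{u}) (hx : ∀ m, ∃ i, x m ∈ (A i).carrier) :
    ∃ i, ∀ m, x m ∈ (A i).carrier := by
  choose i hi using hx
  obtain ⟨k, hk⟩ := Finite.exists_le i
  exact ⟨k, fun m => (hA _ _ (hk m)).1 (hi m)⟩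

/-- Inside a structure that contains every member of a chain, the union of the chain has a
completion. -/
theorem exists_isCompletionOfUnion_isSubstructure
    (hA : ∀ i j, i ≤ j → (A i).IsSubstructure (A j)) (hN : ∀ i, (A i).IsSubstructure N) :
    ∃ U : MetricStructure.{u} L, U.IsSubstructure N ∧ IsCompletionOfUnion A U := by
  set S : Set N.carrier := {x | ∃ i, (x : ZFSet.{u}) ∈ (A i).carrier} with hS
  obtain ⟨U, hU, hUC⟩ := exists_isSubstructure_of_isClosed N (closure S) isClosed_closure (by
    intro n F x hx
    have h1 : x ∈ closure (Set.univ.pi fun _ => S) := by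
      rw [closure_pi_set]; exact fun i _ => hx i
    refine map_mem_closure (N.continuous_func F) h1 fun y hy => ?_
    obtain ⟨k, hk⟩ := exists_forall_mem_carrier hA (fun i => (y i : ZFSet.{u}))
      fun i => hy i trivial
    obtain ⟨h1, -, hF, -⟩ := hN k
    exact ⟨k, hF F (fun i => ⟨y i, hk i⟩) ▸ Subtype.mem _⟩)
  obtain ⟨hU1, hUd, hUf, hUp⟩ := id hU
  refine ⟨U, hU, fun i => ?_, fun x => ?_⟩
  · obtain ⟨h1, hd, hF, hP⟩ := hN i
    refine ⟨fun z hz => (hUC ⟨z, h1 hz⟩).2 (subset_closure ⟨i, hz⟩), fun x y => ?_,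
      fun F x => ?_, fun R x => ?_⟩
    · rw [hUd]; exact hd x y
    · rw [hUf]; exact hF F x
    · rw [hUp]; exact hP R x
  · have hiso : Isometry fun x : U.carrier => (⟨x, hU1 x.2⟩ : N.carrier) :=
      Isometry.of_dist_eq fun x y => (hUd x y).symm
    rw [hiso.isEmbedding.isInducing.closure_eq_preimage_closure_image]
    have hx := (hUC ⟨x, hU1 x.2⟩).1 x.2
    refine closure_mono ?_ hx
    rintro y ⟨i, hi⟩
    exact ⟨⟨y, (hUC y).2 (subset_closure ⟨i, hi⟩)⟩, ⟨i, hi⟩, rfl⟩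

/-- Any two completions of the union of a chain are isomorphic. -/
theorem nonempty_iso_of_isCompletionOfUnion
    (hA : ∀ i j, i ≤ j → (A i).IsSubstructure (A j)) {U U' : MetricStructure.{u} L}
    (hU : IsCompletionOfUnion A U) (hU' : IsCompletionOfUnion A U') : Nonempty (U.Iso U') := by
  obtain ⟨hs, hd⟩ := hU
  obtain ⟨hs', hd'⟩ := hU'
  let V := {x : ZFSet.{u} // ∃ i, x ∈ (A i).carrier}
  let inc : V → U.carrier := fun x => ⟨x, x.2.elim fun i hi => (hs i).1 hi⟩
  let inc' : V → U'.carrier := fun x => ⟨x, x.2.elim fun i hi => (hs' i).1 hi⟩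
  have hinj : Function.Injective inc := fun x y h =>
    Subtype.ext (show (inc x : ZFSet.{u}) = inc y from congrArg Subtype.val h)
  let : MetricSpace V := MetricSpace.induced inc hinj U.metric
  have hiso : Isometry inc := Isometry.of_dist_eq fun _ _ => rfl
  -- Any two points of the union lie in a common member of the chain, which fixes their distance in
  -- both completions; the symbols are treated alike below, and density with continuity extends the
  -- identities.
  have hiso' : Isometry inc' := Isometry.of_dist_eq fun x y => by
    obtain ⟨k, hk⟩ := exists_forall_mem_carrier hA ![x.1, y.1] (by
      intro m; fin_cases m; exacts [x.2, y.2])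
    rw [show dist x y = dist (inc x) (inc y) from rfl]
    exact ((hs' k).2.1 ⟨x, hk 0⟩ ⟨y, hk 1⟩).symm.trans ((hs k).2.1 ⟨x, hk 0⟩ ⟨y, hk 1⟩)
  have hdense : DenseRange inc := by
    refine hd.mono ?_
    rintro x ⟨i, hi⟩
    exact ⟨⟨x, i, hi⟩, rfl⟩
  have hdense' : DenseRange inc' := by
    refine hd'.mono ?_
    rintro x ⟨i, hi⟩
    exact ⟨⟨x, i, hi⟩, rfl⟩
  let p : AbstractCompletion V := ⟨U.carrier, inc, inferInstance, inferInstance, inferInstance,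
    hiso.isUniformInducing, hdense⟩
  let p' : AbstractCompletion V := ⟨U'.carrier, inc', inferInstance, inferInstance, inferInstance,
    hiso'.isUniformInducing, hdense'⟩
  let e : U.carrier ≃ᵤ U'.carrier := p.compareEquiv p'
  have he : ∀ x, e (inc x) = inc' x := p.compare_coe p'
  have hpi : ∀ n, DenseRange fun (y : Fin n → V) (m : Fin n) => inc (y m) := fun n =>
    DenseRange.piMap fun _ => hdense
  have hmap : ∀ n, Continuous fun (x : Fin n → U.carrier) (m : Fin n) => e (x m) := fun n =>
    continuous_pi fun m => e.continuous.comp (continuous_apply m)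
  refine ⟨⟨e.toEquiv, fun x y => ?_, fun {n} F x => ?_, fun {n} R x => ?_⟩⟩
  · refine hdense.induction_on₂ (p := fun x y => dist (e x) (e y) = dist x y)
      (isClosed_eq ((e.continuous.comp continuous_fst).dist (e.continuous.comp continuous_snd))
        continuous_dist) (fun x y => ?_) x y
    rw [he, he, hiso'.dist_eq, hiso.dist_eq]
  · refine (hpi n).induction_on (p := fun x => e (U.func F x) = U'.func F fun i => e (x i)) x
      (isClosed_eq (e.continuous.comp (U.continuous_func F))
        ((U'.continuous_func F).comp (hmap n))) fun y => ?_
    obtain ⟨k, hk⟩ := exists_forall_mem_carrier hA (fun i => (y i : ZFSet.{u})) fun i => (y i).2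
    have h1 : U.func F (fun m => inc (y m)) =
        inc ⟨(A k).func F fun m => ⟨y m, hk m⟩, k, Subtype.mem _⟩ :=
      Subtype.ext ((hs k).2.2.1 F fun m => ⟨y m, hk m⟩).symm
    rw [h1, he]
    simp only [he]
    exact Subtype.ext ((hs' k).2.2.1 F fun m => ⟨y m, hk m⟩)
  · refine (hpi n).induction_on (p := fun x => U'.pred R (fun i => e (x i)) = U.pred R x) x
      (isClosed_eq ((U'.continuous_pred R).comp (hmap n)) (U.continuous_pred R)) fun y => ?_
    obtain ⟨k, hk⟩ := exists_forall_mem_carrier hA (fun i => (y i : ZFSet.{u})) fun i => (y i).2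
    simp only [he]
    exact ((hs' k).2.2.2 R fun m => ⟨y m, hk m⟩).symm.trans
      ((hs k).2.2.2 R fun m => ⟨y m, hk m⟩)

end Union

end MetricStructure

/-! ### Transport of operators, and the graph as zero set of `Γ` -/

section Transport

theorem exists_isSelfAdjoint_transport {H₁ : Type v} [NormedAddCommGroup H₁]
    [InnerProductSpace ℂ H₁] [CompleteSpace H₁] {H₂ : Type w} [NormedAddCommGroup H₂]
    [InnerProductSpace ℂ H₂] [CompleteSpace H₂] (U : H₁ ≃ₗᵢ[ℂ] H₂) {Q : H₂ →ₗ.[ℂ] H₂}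
    (hQ : IsSelfAdjoint Q) :
    ∃ R : H₁ →ₗ.[ℂ] H₁, IsSelfAdjoint R ∧ MapsGraph U.toLinearIsometry R Q := by
  obtain ⟨R, hR, hRG⟩ := exists_isSelfAdjoint_graph_eq
    (Q.graph.comap ((U : H₁ →ₗ[ℂ] H₂).prodMap (U : H₁ →ₗ[ℂ] H₂))) (by
      refine (U.symm.surjective.denseRange.dense_image U.symm.continuous hQ.dense_domain).mono ?_
      rintro _ ⟨x, hx, rfl⟩
      refine ⟨(U.symm x, U.symm (Q ⟨x, hx⟩)), ?_, rfl⟩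
      change (U (U.symm x), U (U.symm (Q ⟨x, hx⟩))) ∈ Q.graph
      rw [U.apply_symm_apply, U.apply_symm_apply]
      exact Q.mem_graph ⟨x, hx⟩) (by
      intro u v
      change (U u, U v) ∈ Q.graph ↔ ∀ x y, (U x, U y) ∈ Q.graph → _
      rw [mem_graph_iff_of_isSelfAdjoint hQ]
      constructor
      · intro h x y hxy
        simpa using h _ _ hxy
      · intro h x y hxy
        have := h (U.symm x) (U.symm y) (by simpa using hxy)
        rw [← U.inner_map_map, ← U.inner_map_map] at this
        simpa using this)
  exact ⟨R, hR, fun x y hxy => by rw [hRG] at hxy; exact hxy⟩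

theorem graphDist_eq_zero_iff {H : Type v} [NormedAddCommGroup H] [InnerProductSpace ℂ H]
    [CompleteSpace H] {Q : H →ₗ.[ℂ] H} (hQ : IsSelfAdjoint Q) {x y : H} :
    graphDist Q x y = 0 ↔ (x, y) ∈ Q.graph := by
  have hc : IsClosed {p : WithLp 2 (H × H) | (p.fst, p.snd) ∈ Q.graph} :=
    (hQ.isClosed : IsClosed (Q.graph : Set (H × H))).preimage (WithLp.prod_continuous_ofLp 2 H H)
  exact (hc.mem_iff_infDist_zero ⟨WithLp.toLp 2 (0, 0), Q.graph.zero_mem⟩).symm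

end Transport

/-! ### Isomorphisms and equality of structures -/

namespace MetricStructure

variable {L : FirstOrder.Language.{a, b}} {M N P : MetricStructure.{u} L}

/-- The inverse of an isomorphism. -/
def Iso.symm (f : M.Iso N) : N.Iso M where
  toEquiv := f.toEquiv.symm
  map_dist x y := by rw [← f.map_dist]; simp
  map_func F x := by rw [Equiv.symm_apply_eq, f.map_func]; simp
  map_pred R x := by rw [← f.map_pred]; simp

/-- The composition of isomorphisms. -/
def Iso.trans (f : M.Iso N) (g : N.Iso P) : M.Iso P where
  toEquiv := f.toEquiv.trans g.toEquiv
  map_dist x y := (g.map_dist _ _).trans (f.map_dist x y)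
  map_func F x := by
    rw [Equiv.trans_apply, f.map_func, g.map_func]; rfl
  map_pred R x := (g.map_pred R _).trans (f.map_pred R x)

theorem Iso.isSubstructure (f : M.Iso N) (hf : ∀ x, (f.toEquiv x : ZFSet.{u}) = x) :
    M.IsSubstructure N := by
  have hsub : M.carrier ⊆ N.carrier := fun z hz => by
    have := (f.toEquiv ⟨z, hz⟩).2
    rwa [hf] at this
  have key : ∀ x : M.carrier, (⟨x, hsub x.2⟩ : N.carrier) = f.toEquiv x := fun x =>
    Subtype.ext (hf x).symm
  refine ⟨hsub, fun x y => ?_, fun F x => ?_, fun R x => ?_⟩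
  · rw [key, key, f.map_dist]
  · simp only [key]
    rw [← f.map_func, hf]
  · simp only [key]
    rw [f.map_pred]

theorem Iso.eq (f : M.Iso N) (hf : ∀ x, (f.toEquiv x : ZFSet.{u}) = x) : M = N :=
  (f.isSubstructure hf).antisymm (f.symm.isSubstructure fun x => by
    rw [← hf]; simp [Iso.symm])

end MetricStructure

/-! ### Hilbert space operator structures and their substructures -/

namespace HilbertOperator

variable {X Y : HilbertOperator.{u}}

theorem map_func (e : X.carrier →ₗᵢ[ℂ] Y.carrier) {n : ℕ} (F : HilbertFunc n)
    (x : Fin n → X.carrier) : e (X.func F x) = Y.func F fun i => e (x i) := by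
  cases F <;> simp [func]

theorem map_pred {e : X.carrier →ₗᵢ[ℂ] Y.carrier} (he : MapsGraph e X.op Y.op) {n : ℕ}
    (R : HilbertPred n) (x : Fin n → X.carrier) :
    Y.pred R (fun i => e (x i)) = X.pred R x := by
  cases R
  · simp [pred]
  · exact he.graphDist_eq X.selfAdjoint Y.selfAdjoint _ _

/-- A unitary equivalence induces an isomorphism of structures. -/
noncomputable def isoOfLinearIsometryEquiv (U : X.carrier ≃ₗᵢ[ℂ] Y.carrier)
    (hU : MapsGraph U.toLinearIsometry X.op Y.op) :
    X.toMetricStructure.Iso Y.toMetricStructure where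
  toEquiv := U.toEquiv
  map_dist := U.dist_map
  map_func F x := map_func U.toLinearIsometry F x
  map_pred R x := map_pred hU R x

/-- The metric structure remembers everything: addition, multiplication by `i` and the metric make
the inclusion a complex-linear isometry, and `Γ = 0` recovers the graph. -/
theorem isSubOperator_iff :
    X.IsSubOperator Y ↔ X.toMetricStructure.IsSubstructure Y.toMetricStructure := by
  constructor
  · rintro ⟨e, hv, he⟩
    have hsub : X.carrier ⊆ Y.carrier := fun z hz => by
      have := (e ⟨z, hz⟩).2
      rwa [hv] at this
    have key : ∀ x : X.carrier, (⟨x, hsub x.2⟩ : Y.carrier) = e x := fun x =>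
      Subtype.ext (hv x).symm
    refine ⟨hsub, fun x y => ?_, fun F x => ?_, fun R x => ?_⟩
    · exact ((congrArg₂ dist (key x) (key y)).trans (e.dist_map x y)).symm
    · exact ((hv _).symm.trans (congrArg Subtype.val (map_func e F x))).trans
        (congrArg (fun z => (Y.func F z : ZFSet.{u})) (funext fun i => (key (x i)).symm))
    · exact (map_pred he R x).symm.trans (congrArg (Y.pred R) (funext fun i => (key (x i)).symm))
  · rintro ⟨hsub, hd, hF, hP⟩
    let i : X.carrier → Y.carrier := fun x => ⟨x, hsub x.2⟩
    have hiso : Isometry i := Isometry.of_dist_eq fun x y => (hd x y).symm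
    have hadd : ∀ x y, i (x + y) = i x + i y := fun x y => by
      have h := hF HilbertFunc.add ![x, y]
      exact Subtype.ext h
    have hI : ∀ x, i (Complex.I • x) = Complex.I • i x := fun x => by
      have h := hF HilbertFunc.mulI ![x]
      exact Subtype.ext h
    -- A continuous additive map is real-linear; compatibility with `i` then gives complex
    -- linearity.
    let g := (AddMonoidHom.mk' i hadd).toRealLinearMap hiso.continuous
    have hreal : ∀ (r : ℝ) x, i ((r : ℂ) • x) = (r : ℂ) • i x := fun r x => by
      rw [Complex.coe_smul, Complex.coe_smul]
      exact g.map_smul r x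
    have hsmul : ∀ (c : ℂ) x, i (c • x) = c • i x := fun c x => by
      conv_lhs => rw [← Complex.re_add_im c, add_smul, mul_smul, hadd, hreal, hreal, hI,
        smul_smul, ← add_smul, Complex.re_add_im]
    have h0 : i 0 = 0 := by simpa using hsmul 0 0
    refine ⟨⟨⟨⟨i, hadd⟩, hsmul⟩, fun x => ?_⟩, fun x => rfl, fun x y hxy => ?_⟩
    · change ‖i x‖ = ‖x‖
      have := hiso.dist_eq x 0
      rwa [h0, dist_zero_right, dist_zero_right] at this
    · have h := hP HilbertPred.graph ![x, y]
      change graphDist X.op x y = graphDist Y.op (i x) (i y) at h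
      rw [(graphDist_eq_zero_iff X.selfAdjoint).2 hxy] at h
      exact (graphDist_eq_zero_iff Y.selfAdjoint).1 h.symm

/-- Every Hilbert space with a self-adjoint operator can be transported to any set of the
set-theoretic universe of the same cardinality. -/
theorem exists_of_equiv {H : Type v} [NormedAddCommGroup H] [InnerProductSpace ℂ H]
    [CompleteSpace H] {Q : H →ₗ.[ℂ] H} (hQ : IsSelfAdjoint Q) (c : ZFSet.{u}) (e : c ≃ H) :
    ∃ (X : HilbertOperator.{u}) (U : X.carrier ≃ₗᵢ[ℂ] H),
      MapsGraph U.toLinearIsometry X.op Q ∧ ∃ h : ∀ {z}, z ∈ X.carrier → z ∈ c,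
        ∀ x : X.carrier, U x = e ⟨x, h x.2⟩ := by
  let : AddCommGroup c := e.addCommGroup
  let : Module ℂ c := e.module ℂ
  let el : c ≃ₗ[ℂ] H := e.linearEquiv ℂ
  let : NormedAddCommGroup c := NormedAddCommGroup.induced c H el el.injective
  let : InnerProductSpace ℂ c :=
    { norm_smul_le := fun r x => by
        change ‖el (r • x)‖ ≤ ‖r‖ * ‖el x‖
        rw [map_smul, norm_smul]
      inner := fun x y => ⟪el x, el y⟫_ℂ
      norm_sq_eq_re_inner := fun x => norm_sq_eq_re_inner (el x)
      conj_inner_symm := fun x y => inner_conj_symm (el x) (el y)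
      add_left := fun x y z => by rw [map_add, inner_add_left]
      smul_left := fun x y r => by rw [map_smul, inner_smul_left] }
  let U : c ≃ₗᵢ[ℂ] H := ⟨el, fun _ => rfl⟩
  have : CompleteSpace c := (completeSpace_congr U.isometry.isUniformEmbedding).2 inferInstance
  obtain ⟨R, hR, hRU⟩ := exists_isSelfAdjoint_transport U hQ
  exact ⟨⟨c, inferInstance, inferInstance, inferInstance, R, hR⟩, U, hRU, fun h => h, fun x => rfl⟩

end HilbertOperator

/-! ### The order on the class and closure under isomorphism -/

section Class

variable {H : Type v} [NormedAddCommGroup H] [InnerProductSpace ℂ H] {Q : H →ₗ.[ℂ] H}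

theorem kPrec_iff {M N : MetricStructure.{u} hilbertLanguage} :
    KPrec Q M N ↔ M ∈ KClass Q ∧ N ∈ KClass Q ∧ M.IsSubstructure N := by
  refine and_congr_right fun hM => and_congr_right fun hN => ⟨?_, fun h => ?_⟩
  · rintro ⟨X, Y, rfl, rfl, h⟩
    exact HilbertOperator.isSubOperator_iff.1 h
  · obtain ⟨X, rfl, -⟩ := hM
    obtain ⟨Y, rfl, -⟩ := hN
    exact ⟨X, Y, rfl, rfl, HilbertOperator.isSubOperator_iff.2 h⟩

/-- The Hilbert structure is pulled back along the bijection to the carrier of `N`. The resulting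
structure equals `N` itself, because the identity of the carrier is an isomorphism between them. -/
theorem mem_kClass_of_iso {M N : MetricStructure.{u} hilbertLanguage} (hM : M ∈ KClass Q)
    (f : M.Iso N) : N ∈ KClass Q := by
  obtain ⟨X, rfl, hX⟩ := hM
  obtain ⟨Y, U, hU, h, hYU⟩ := HilbertOperator.exists_of_equiv X.selfAdjoint N.carrier
    f.toEquiv.symm
  refine ⟨Y, ((HilbertOperator.isoOfLinearIsometryEquiv U hU).trans f).eq fun x => ?_,
    (spectrallyEquivalent_of_linearIsometryEquiv U hU Y.selfAdjoint X.selfAdjoint).trans hX⟩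
  exact (congrArg (fun z => (f.toEquiv z : ZFSet.{u})) (hYU x)).trans
    (congrArg Subtype.val (f.toEquiv.apply_symm_apply _))

end Class

/-! ### Direct limits of Hilbert spaces -/

section DirectLimit

variable {ι : Type a} [Preorder ι] [IsDirectedOrder ι] [Nonempty ι]
  {G : ι → Type v} [∀ i, NormedAddCommGroup (G i)] [∀ i, InnerProductSpace ℂ (G i)]
  (f : ∀ i j, i ≤ j → G i →ₗᵢ[ℂ] G j) [DirectedSystem G (f · · ·)]

/-- The inner product on the direct limit of a directed system of inner product spaces. -/
@[reducible]
noncomputable def directLimitCore : InnerProductSpace.Core ℂ (DirectLimit G f) where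
  inner := DirectLimit.lift₂ f f (fun _ x y => ⟪x, y⟫_ℂ)
    fun i j h x y => ((f i j h).inner_map_map x y).symm
  conj_inner_symm := DirectLimit.induction₂ f fun i x y => by
    simp only [DirectLimit.lift₂_def, inner_conj_symm]
  re_inner_nonneg := DirectLimit.induction f fun i x => by
    simp only [DirectLimit.lift₂_def]
    exact inner_self_nonneg
  add_left := DirectLimit.induction₃ f fun i x y z => by
    simp only [DirectLimit.add_def, DirectLimit.lift₂_def, inner_add_left]
  smul_left x y r := by
    induction x, y using DirectLimit.induction₂ with
    | ih i x y => simp only [DirectLimit.smul_def, DirectLimit.lift₂_def, inner_smul_left]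
  definite := DirectLimit.induction f fun i x hx => by
    simp only [DirectLimit.lift₂_def, inner_self_eq_zero] at hx
    rw [hx, DirectLimit.zero_def i]

/-- A directed system of inner product spaces has a Hilbert space as its limit. -/
theorem exists_hilbert_limit :
    ∃ (K : Type (max a v)) (_ : NormedAddCommGroup K) (_ : InnerProductSpace ℂ K)
      (_ : CompleteSpace K) (j : ∀ i, G i →ₗᵢ[ℂ] K),
      (∀ i k h x, j k (f i k h x) = j i x) ∧ Dense (⋃ i, Set.range (j i)) := by
  let core := directLimitCore f
  let _ : NormedAddCommGroup (DirectLimit G f) := core.toNormedAddCommGroup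
  let _ : InnerProductSpace ℂ (DirectLimit G f) := InnerProductSpace.ofCore core.toCore
  let j₀ : ∀ i, G i →ₗᵢ[ℂ] DirectLimit G f := fun i =>
    LinearMap.isometryOfInner
      { toFun := fun x => ⟦⟨i, x⟩⟧
        map_add' := fun x y => (DirectLimit.add_def i x y).symm
        map_smul' := fun r x => (DirectLimit.smul_def i x r).symm }
      fun x y => DirectLimit.lift₂_def f f _ _ i x y
  refine ⟨UniformSpace.Completion (DirectLimit G f), inferInstance, inferInstance, inferInstance,
    fun i => UniformSpace.Completion.toComplₗᵢ.comp (j₀ i), fun i k h x => ?_, ?_⟩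
  · refine congrArg ((↑) : DirectLimit G f → UniformSpace.Completion (DirectLimit G f)) ?_
    exact (DirectLimit.mk_apply i k x h)
  · refine UniformSpace.Completion.denseRange_coe.mono ?_
    rintro _ ⟨x, rfl⟩
    obtain ⟨i, y, rfl⟩ := DirectLimit.exists_eq_mk f x
    exact Set.mem_iUnion.2 ⟨i, y, rfl⟩

end DirectLimit

/-! ### Realising the limit on a set containing the given carriers -/

section SetTheory

theorem exists_injective_zfset (α : Type w) [Small.{u} α] :
    ∃ g : α → ZFSet.{u}, Function.Injective g :=
  ⟨fun x => (Ordinal.typein (WellOrderingRel (α := Shrink.{u} α)) (equivShrink α x)).toZFSet,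
    Ordinal.toZFSet_injective.comp ((Ordinal.typein_injective _).comp (equivShrink α).injective)⟩

/-- Extend a set to a set of the same size as a given larger small type. -/
theorem exists_zfset_equiv_extending {α : Type w} [Small.{u} α] (V : ZFSet.{u}) (j : V → α)
    (hj : Function.Injective j) :
    ∃ (c : ZFSet.{u}) (e : c ≃ α), ∀ z (h : z ∈ V), ∃ h' : z ∈ c, e ⟨z, h'⟩ = j ⟨z, h⟩ := by
  classical
  obtain ⟨g, hg⟩ := exists_injective_zfset.{u} α
  -- The new points are pairs with first entry `V`; their rank exceeds that of `V`, so they cannot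
  -- collide with old points.
  have hnot : ∀ w, ZFSet.pair V w ∉ V := by
    intro w h
    have h1 : V ∈ ({V} : ZFSet.{u}) := ZFSet.mem_singleton.2 rfl
    have h2 : ({V} : ZFSet.{u}) ∈ ZFSet.pair V w := ZFSet.mem_pair.2 (Or.inl rfl)
    exact (((ZFSet.rank_lt_of_mem h1).trans (ZFSet.rank_lt_of_mem h2)).trans
      (ZFSet.rank_lt_of_mem h)).false
  let φ : α → ZFSet.{u} := fun y => if h : ∃ x, j x = y then h.choose else ZFSet.pair V (g y)
  have hφj : ∀ x, φ (j x) = x := by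
    intro x
    have h : ∃ x', j x' = j x := ⟨x, rfl⟩
    simp only [φ, dif_pos h]
    rw [hj h.choose_spec]
  have hφ : Function.Injective φ := by
    intro y z hyz
    by_cases hy : ∃ x, j x = y <;> by_cases hz : ∃ x, j x = z
    · obtain ⟨x, rfl⟩ := hy
      obtain ⟨x', rfl⟩ := hz
      rw [hφj, hφj] at hyz
      rw [Subtype.ext hyz]
    · obtain ⟨x, rfl⟩ := hy
      rw [hφj] at hyz
      simp only [φ, dif_neg hz] at hyz
      exact absurd (hyz ▸ x.2) (hnot _)
    · obtain ⟨x, rfl⟩ := hz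
      rw [hφj] at hyz
      simp only [φ, dif_neg hy] at hyz
      exact absurd (hyz ▸ x.2) (hnot _)
    · simp only [φ, dif_neg hy, dif_neg hz] at hyz
      exact hg (ZFSet.pair_injective hyz).2
  have hmem : ∀ y, φ y ∈ ZFSet.range φ := fun y => ZFSet.mem_range_self y
  let e : α ≃ ZFSet.range φ := Equiv.ofBijective (fun y => ⟨φ y, hmem y⟩)
    ⟨fun y z h => hφ (Subtype.ext_iff.1 h), fun ⟨z, hz⟩ => by
      obtain ⟨y, rfl⟩ := ZFSet.mem_range.1 hz
      exact ⟨y, rfl⟩⟩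
  refine ⟨ZFSet.range φ, e.symm, fun z h => ?_⟩
  have h' : z ∈ ZFSet.range φ := by
    have := hmem (j ⟨z, h⟩); rwa [hφj] at this
  refine ⟨h', ?_⟩
  rw [Equiv.symm_apply_eq]
  exact Subtype.ext (hφj ⟨z, h⟩).symm

/-- A point is determined by its distances to a dense set. This brings the limit space, formed one
universe up, back to the size of a set. -/
theorem small_of_dense {K : Type w} [MetricSpace K] {α : Type v} [Small.{u} α] (f : α → K)
    (hf : DenseRange f) : Small.{u} K := by
  refine small_of_injective (β := α → ℝ) (f := fun x a => dist x (f a)) fun x y h => ?_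
  have h1 : ∀ z, dist x z = dist y z := fun z =>
    hf.induction_on z (isClosed_eq (by fun_prop) (by fun_prop)) fun a => congrFun h a
  simpa using h1 y

end SetTheory

/-! ### The axioms for the class -/

section Class

variable {H : Type v} [NormedAddCommGroup H] [InnerProductSpace ℂ H] {Q : H →ₗ.[ℂ] H}

theorem HilbertOperator.mem_of_exists_of_equiv {c : ZFSet.{u}} {X : HilbertOperator.{u}}
    {α : Type v} {e : c ≃ α} {U : X.carrier → α} (hU : Function.Surjective U)
    (h : ∀ {z}, z ∈ X.carrier → z ∈ c) (hUe : ∀ x : X.carrier, U x = e ⟨x, h x.2⟩)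
    {z : ZFSet.{u}} (hz : z ∈ c) : z ∈ X.carrier := by
  obtain ⟨x, hx⟩ := hU (e ⟨z, hz⟩)
  rw [hUe, e.apply_eq_iff_eq] at hx
  have hxz : (x : ZFSet.{u}) = z := Subtype.ext_iff.1 hx
  exact hxz ▸ x.2

/-- The Hilbert space limit is only abstract, whereas a completion must literally contain each
carrier. It is therefore transported to a set extending the union of the carriers. -/
theorem exists_isCompletionOfUnion_mem_kClass {ι : Type u} [LinearOrder ι] [Nonempty ι]
    {M : ι → MetricStructure.{u} hilbertLanguage} (hM : ∀ i, M i ∈ KClass Q)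
    (hmono : ∀ i j, i ≤ j → (M i).IsSubstructure (M j)) :
    ∃ U ∈ KClass Q, MetricStructure.IsCompletionOfUnion M U := by
  choose X hX hXQ using hM
  obtain rfl : (fun i => (X i).toMetricStructure) = M := funext hX
  simp only [← HilbertOperator.isSubOperator_iff] at hmono
  choose f hf hfG using hmono
  have hsys : DirectedSystem (fun i => (X i).carrier) (f · · ·) :=
    ⟨fun i x => Subtype.ext (hf i i le_rfl x), fun k j i hij hjk x => Subtype.ext
      ((hf _ _ _ _).trans ((hf _ _ _ _).trans (hf _ _ _ _).symm))⟩
  obtain ⟨K, _, _, _, j, hj, hdense⟩ := exists_hilbert_limit f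
  obtain ⟨R, hR, hRj⟩ := exists_isSelfAdjoint_limit (j := j) (fun i => (X i).selfAdjoint)
    (fun i k h => ⟨f i k h, hfG i k h, hj i k h⟩) hdense
  have hrange : ∀ i k, i ≤ k → Set.range (j i) ⊆ Set.range (j k) := by
    rintro i k h _ ⟨x, rfl⟩
    exact ⟨_, hj i k h x⟩
  let o : ι := Classical.arbitrary ι
  have hRQ := (spectrallyEquivalent_limit (fun i => (X i).selfAdjoint) hR hRj hrange hdense o
    fun i => (hXQ i).trans (hXQ o).symm).symm.trans (hXQ o)
  -- the elements of the union, as vectors of the limit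
  have hj' : ∀ i k z (hi : z ∈ (X i).carrier) (hk : z ∈ (X k).carrier),
      j i ⟨z, hi⟩ = j k ⟨z, hk⟩ := by
    have h1 : ∀ i k, i ≤ k → ∀ z (hi : z ∈ (X i).carrier) (hk : z ∈ (X k).carrier),
        j i ⟨z, hi⟩ = j k ⟨z, hk⟩ := by
      intro i k h z hi hk
      rw [← hj i k h]
      exact congrArg (j k) (Subtype.ext (hf i k h _))
    intro i k z hi hk
    rcases le_total i k with h | h
    exacts [h1 i k h z hi hk, (h1 k i h z hk hi).symm]
  let V : ZFSet.{u} := ZFSet.iUnion fun i => (X i).carrier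
  have hV : ∀ {z}, z ∈ V ↔ ∃ i, z ∈ (X i).carrier := by
    intro z; simp [V]
  choose n hn using fun z : V => hV.1 z.2
  have hinj : Function.Injective fun z : V => j (n z) ⟨z, hn z⟩ := by
    intro z z' h
    have h2 : ∃ k, (z : ZFSet.{u}) ∈ (X k).carrier ∧ (z' : ZFSet.{u}) ∈ (X k).carrier :=
      ⟨max (n z) (n z'), hf _ _ (le_max_left _ _) ⟨z, hn z⟩ ▸ Subtype.mem _,
        hf _ _ (le_max_right _ _) ⟨z', hn z'⟩ ▸ Subtype.mem _⟩
    obtain ⟨k, hk, hk'⟩ := h2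
    have h3 : j k ⟨z, hk⟩ = j k ⟨z', hk'⟩ := by
      rw [hj' k (n z) z hk (hn z), hj' k (n z') z' hk' (hn z')]; exact h
    exact Subtype.ext (Subtype.ext_iff.1 ((j k).injective h3) :)
  have hsmall : Small.{u} K := small_of_dense (fun z : V => j (n z) ⟨z, hn z⟩) (by
    refine hdense.mono (Set.iUnion_subset fun i => ?_)
    rintro _ ⟨x, rfl⟩
    exact ⟨⟨x, hV.2 ⟨i, x.2⟩⟩, hj' _ _ _ _ _⟩)
  obtain ⟨c, e, he⟩ := exists_zfset_equiv_extending V _ hinj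
  obtain ⟨Y, U, hU, hYc, hUe⟩ := HilbertOperator.exists_of_equiv hR c e
  have hcY := fun {z} => HilbertOperator.mem_of_exists_of_equiv (z := z) U.surjective hYc hUe
  have hUj : ∀ i (x : (X i).carrier), (U.symm (j i x) : ZFSet.{u}) = x := by
    intro i x
    obtain ⟨hxc, hx⟩ := he x (hV.2 ⟨i, x.2⟩)
    have h1 : U ⟨x, hcY hxc⟩ = j i x := by
      rw [hUe, hx]; exact hj' _ _ _ _ _
    rw [← h1, U.symm_apply_apply]
  refine ⟨Y.toMetricStructure, ⟨Y, rfl,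
    (spectrallyEquivalent_of_linearIsometryEquiv U hU Y.selfAdjoint hR).trans hRQ⟩,
    fun i => HilbertOperator.isSubOperator_iff.1
      ⟨U.symm.toLinearIsometry.comp (j i), hUj i, fun x y hxy => ?_⟩, ?_⟩
  · rw [← hU.mem_graph_iff Y.selfAdjoint hR]
    simpa using hRj i x y hxy
  · refine (U.symm.surjective.denseRange.dense_image U.symm.continuous hdense).mono ?_
    rintro _ ⟨x, hx, rfl⟩
    obtain ⟨i, y, rfl⟩ := Set.mem_iUnion.1 hx
    exact ⟨i, by rw [hUj]; exact y.2⟩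

theorem mk_symbols_hilbertLanguage_le : hilbertLanguage.card ≤ ℵ₀ := by
  have h1 : Countable (Σ n, HilbertFunc n) := by
    have : ∀ n, Countable (HilbertFunc n) := fun n => by
      let g : HilbertFunc n → ℕ × ℚ := fun F => match F with
        | .zero => (0, 0)
        | .neg => (1, 0)
        | .mulI => (2, 0)
        | .ratMul r => (3, r)
        | .add => (4, 0)
      refine Function.Injective.countable (f := g) fun F G h => ?_
      cases F <;> cases G <;> simp_all [g]
    infer_instance
  have h2 : Countable (Σ n, HilbertPred n) := by
    have : ∀ n, Countable (HilbertPred n) := fun n => by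
      have : Subsingleton (HilbertPred n) := ⟨fun R S => by cases R <;> cases S <;> rfl⟩
      infer_instance
    infer_instance
  have h3 : Countable hilbertLanguage.Symbols :=
    inferInstanceAs (Countable ((Σ n, HilbertFunc n) ⊕ Σ n, HilbertPred n))
  exact Cardinal.mk_le_aleph0

theorem isLSCardinal_continuum :
    IsLSCardinal (KClass.{u} Q) (KPrec.{u} Q) Cardinal.continuum.{u} := by
  refine ⟨?_, fun M hM A hA => ?_⟩
  · rw [Cardinal.lift_continuum]
    have := Cardinal.lift_le_aleph0.{0, u}.2 mk_symbols_hilbertLanguage_le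
    exact (add_le_add le_rfl this).trans
      (by rw [Cardinal.aleph0_add_aleph0]; exact Cardinal.aleph0_le_continuum)
  · obtain ⟨X, rfl, hXQ⟩ := id hM
    obtain ⟨N, R, hN, hR, hRX, hRe, hAN, s, hs, hsc⟩ :=
      exists_spectrallyEquivalent_restrict X.selfAdjoint (((↑) : X.carrier → ZFSet.{u}) ⁻¹' A)
    let c : ZFSet.{u} := ZFSet.sep (fun z => ∃ h : z ∈ X.carrier, (⟨z, h⟩ : X.carrier) ∈ N) X.carrier
    have hc : ∀ {z}, z ∈ c ↔ ∃ h : z ∈ X.carrier, (⟨z, h⟩ : X.carrier) ∈ N := by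
      intro z
      rw [ZFSet.mem_sep]
      exact ⟨fun h => h.2, fun h => ⟨h.1, h⟩⟩
    let e : c ≃ N :=
      { toFun := fun z => ⟨⟨z, (hc.1 z.2).1⟩, (hc.1 z.2).2⟩
        invFun := fun x => ⟨x.1, hc.2 ⟨x.1.2, x.2⟩⟩
        left_inv := fun z => rfl
        right_inv := fun x => rfl }
    obtain ⟨Y, U, hU, hYc, hUe⟩ := HilbertOperator.exists_of_equiv hR c e
    have hcY := fun {z} => HilbertOperator.mem_of_exists_of_equiv (z := z) U.surjective hYc hUe
    have hYK : Y.toMetricStructure ∈ KClass Q := ⟨Y, rfl,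
      ((spectrallyEquivalent_of_linearIsometryEquiv U hU Y.selfAdjoint hR).trans hRe).trans hXQ⟩
    refine ⟨Y.toMetricStructure, hYK, ⟨hYK, hM, Y, X, rfl, rfl,
      N.subtypeₗᵢ.comp U.toLinearIsometry, fun x => ?_, fun x y hxy => hRX _ _ (hU x y hxy)⟩,
      fun z hz => hcY (hc.2 ⟨hA z hz, hAN hz⟩), ?_⟩
    · change ((U x : X.carrier) : ZFSet.{u}) = x
      rw [hUe]
      rfl
    · have hd : Dense (U.symm '' s) :=
        U.symm.surjective.denseRange.dense_image U.symm.continuous hs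
      calc Y.toMetricStructure.dens ≤ #(U.symm '' s) := csInf_le' ⟨_, hd, rfl⟩
        _ ≤ #s := Cardinal.mk_image_le
        _ ≤ _ := hsc
        _ ≤ _ := by
          rw [Cardinal.lift_continuum]
          exact add_le_add (Cardinal.mk_preimage_of_injective _ _ Subtype.val_injective) le_rfl

theorem isMAEC_kClass : IsMAEC (KClass.{u} Q) (KPrec.{u} Q) where
  mem_of_prec M N h := ⟨h.1, h.2.1⟩
  refl M hM := kPrec_iff.2 ⟨hM, hM, .refl M⟩
  trans M N P h h' := by
    rw [kPrec_iff] at *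
    exact ⟨h.1, h'.2.1, h.2.2.trans h'.2.2⟩
  antisymm M N h h' := (kPrec_iff.1 h).2.2.antisymm (kPrec_iff.1 h').2.2
  mem_of_iso M N hM f := mem_kClass_of_iso hM f.some
  prec_of_iso N₁ _ N₂ _ M₁ h₁ M₂ h₂ f₁ f₂ hf h :=
    kPrec_iff.2 ⟨h₁, h₂, (kPrec_iff.1 h).2.2.of_iso f₁ f₂ hf⟩
  isSubstructure_of_prec M _ N _ h := (kPrec_iff.1 h).2.2
  coherence M N P hMN hM hN := kPrec_iff.2 ⟨hM.1, hN.1, hMN⟩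
  exists_isLSCardinal := ⟨_, isLSCardinal_continuum⟩
  chain_below ι _ _ _ N M hN hM hMN hmono := by
    have hle : ∀ i j, i ≤ j → (M i).IsSubstructure (M j) := fun i j h => by
      rcases h.eq_or_lt with rfl | h
      exacts [.refl _, (kPrec_iff.1 (hmono i j h)).2.2]
    refine ⟨MetricStructure.exists_isCompletionOfUnion_isSubstructure hle
      fun i => (kPrec_iff.1 (hMN i)).2.2, fun U hUN hU => ?_⟩
    -- The given `U` is isomorphic to the completion built from the limit operator, so membership
    -- passes to it; its position below `N` is then the substructure relation alone.
    obtain ⟨U', hU', hc⟩ := exists_isCompletionOfUnion_mem_kClass hM hle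
    have hUK := mem_kClass_of_iso hU'
      (MetricStructure.nonempty_iso_of_isCompletionOfUnion hle hc hU).some
    exact ⟨hUK, kPrec_iff.2 ⟨hUK, hN, hUN⟩⟩
  chain ι _ _ _ M hM hmono := by
    have hle : ∀ i j, i ≤ j → (M i).IsSubstructure (M j) := fun i j h => by
      rcases h.eq_or_lt with rfl | h
      exacts [.refl _, (kPrec_iff.1 (hmono i j h)).2.2]
    obtain ⟨U', hU', hc⟩ := exists_isCompletionOfUnion_mem_kClass hM hle
    refine ⟨⟨U', hc⟩, fun U hU => ?_⟩
    have hUK := mem_kClass_of_iso hU'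
      (MetricStructure.nonempty_iso_of_isCompletionOfUnion hle hc hU).some
    exact ⟨hUK, fun i => kPrec_iff.2 ⟨hM i, hUK, hU.1 i⟩⟩

end Class

end SpectralMAEC

theorem mainTheorem3 {H : Type v} [NormedAddCommGroup H] [InnerProductSpace ℂ H]
    [CompleteSpace H] (Q : H →ₗ.[ℂ] H) (hQ : IsSelfAdjoint Q) :
    SpectralMAEC.IsMAEC (SpectralMAEC.KClass.{u} Q) (SpectralMAEC.KPrec.{u} Q) ∧
      SpectralMAEC.lsNumber (SpectralMAEC.KClass.{u} Q) (SpectralMAEC.KPrec.{u} Q) ≤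
        (2 : Cardinal.{u}) ^ ((2 : Cardinal.{u}) ^ Cardinal.aleph0.{u}) := by
  have h : SpectralMAEC.lsNumber (SpectralMAEC.KClass.{u} Q) (SpectralMAEC.KPrec.{u} Q) ≤
      Cardinal.continuum.{u} := csInf_le' SpectralMAEC.isLSCardinal_continuum
  refine ⟨SpectralMAEC.isMAEC_kClass, h.trans ?_⟩
  -- The bound obtained is the continuum itself; Cantor's theorem weakens it to the stated one.
  rw [Cardinal.two_power_aleph0]
  exact (Cardinal.cantor _).le
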